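/- Let $h_n(t)=\big(2^{n-1}(n-1)!\sqrt\pi\big)^{-1/2}(-1)^{n-1}e^{t^2/2}\frac{d^{n-1}}{dt^{n-1}}\big(e^{-t^2}\big)$, $n\in\mathbb N=\{1,2,\dots\}$, be the Hermite orthonormal basis of $L^2(\mathbb R)$. Let $(e_n)_{n=1}^\infty$ be a sequence of functions in $\mathcal S(\mathbb R)$ that is a frame for $L^2(\mathbb R)$, i.e. there are constants $A,B>0$ with $A\|h\|^2\le\sum_{n=1}^\infty|(h,e_n)_{L^2}|^2\le B\|h\|^2$ for all $h\in L^2(\mathbb R)$, and suppose that it is polynomially localized with respect to $(h_n)$ with every decay $s\in\mathbb N$: for each $s\in\mathbb N$ there is a constant $C_s$ such that $|(e_m,h_n)_{L^2}|\le C_s(1+|m-n|)^{-s}$ for all $m,n\in\mathbb N$. Let $L$ be slowly varying at infinity, i.e. a real-valued function, measurable and positive on some $[A_0,\infty)$ with $A_0>0$, such that $\lim_{\lambda\to\infty}L(a\lambda)/L(\lambda)=1$ for each $a>0$; let $\alpha\in\mathbb R$ and $f\in\mathcal S'(\mathbb R)$. For $\lambda>0$ let $f(\lambda\,\cdot)\in\mathcal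 S'(\mathbb R)$ be the dilation $\langle f(\lambda\,\cdot),\varphi\rangle=\lambda^{-1}\langle f,\varphi(\cdot/\lambda)\rangle$, where $\langle\cdot,\cdot\rangle$ is the bilinear dual pairing. Then there exists $g\in\mathcal S'(\mathbb R)$ such that $$\lim_{\lambda\to\infty}\Big\langle\frac{f(\lambda\,\cdot)}{\lambda^\alpha L(\lambda)},\varphi\Big\rangle=\langle g,\varphi\rangle\quad\text{for every }\varphi\in\mathcal S(\mathbb R)$$ (that is, $f$ has quasiasymptotic behavior of degree $\alpha$ at infinity with respect to $L$) if and only if the following two conditions hold: (i) the limit $\displaystyle\lim_{\lambda\to\infty}\Big\langle\frac{f(\lambda\,\cdot)}{\lambda^\alpha L(\lambda)},e_n\Big\rangle$ exists in $\mathbb C$ for each $n\in\mathbb N$; (ii) there exist $k\in\mathbb N_0$ and $\lambda_0>0$ such that $$\sup_{\lambda\ge\lambda_0}\ \sup_{n\in\mathbb N}\frac{|\langle f(\lambda\,\cdot),e_n\rangle|}{\lambda^\alpha L(\lambda)\,n^k}<\infty .$$ -/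

import Mathlib

open Filter Topology MeasureTheory
open scoped SchwartzMap ENNReal

noncomputable section

/-- The Hilbert space `L²(ℝ)` of complex-valued functions. -/
abbrev L2R : Type := Lp ℂ 2 (volume : Measure ℝ)

/-! ### Frames and localization -/

/-- `u` is a frame for the Hilbert space `H`: there are `A, B > 0` with
`A ‖h‖² ≤ ∑ |(h, u i)|² ≤ B ‖h‖²` for every `h ∈ H`.
The pairing `(h, u)` of the mathematical literature, linear in `h`, is `inner ℂ u h`. -/
def IsFrame {H ι : Type*} [NormedAddCommGroup H] [InnerProductSpace ℂ H] (u : ι → H) : Prop :=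
  ∃ A > (0 : ℝ), ∃ B > (0 : ℝ), ∀ h : H,
    Summable (fun i => ‖inner ℂ (u i) h‖ ^ 2) ∧
    A * ‖h‖ ^ 2 ≤ ∑' i, ‖inner ℂ (u i) h‖ ^ 2 ∧
    ∑' i, ‖inner ℂ (u i) h‖ ^ 2 ≤ B * ‖h‖ ^ 2

/-- `r` and `r'` are biorthogonal: `(r m, r' n) = δ_{mn}`. -/
def IsBiorthogonal {H ι : Type*} [NormedAddCommGroup H] [InnerProductSpace ℂ H]
    (r r' : ι → H) : Prop :=
  (∀ n, inner ℂ (r' n) (r n) = 1) ∧ ∀ m n, m ≠ n → inner ℂ (r' n) (r m) = 0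

/-- The sequence `(u_n)_{n ≥ 1}` is polynomially localized with decay `γ` with respect to the
Riesz basis `(r_n)_{n ≥ 1}`: with `r'` the sequence biorthogonal to `r`
(it is unique when `r` is a Riesz basis), there is a constant `C` such that
`max (|(u_m, r_n)|, |(u_m, r'_n)|) ≤ C (1 + |m - n|)^(-γ)` for all `m, n ≥ 1`. -/
def IsPolynomiallyLocalized {H : Type*} [NormedAddCommGroup H] [InnerProductSpace ℂ H]
    (γ : ℝ) (u r : ℕ+ → H) : Prop :=
  ∃ r' : ℕ+ → H, IsBiorthogonal r r' ∧ ∃ C : ℝ, ∀ m n : ℕ+,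
    max ‖inner ℂ (r n) (u m)‖ ‖inner ℂ (r' n) (u m)‖
      ≤ C * (1 + |(m : ℝ) - (n : ℝ)|) ^ (-γ)

/-! ### The Hermite basis -/

/-- The `n`-th Hermite function (`n ≥ 0`),
`(2ⁿ n! √π)^(-1/2) (-1)ⁿ e^{t²/2} (d/dt)ⁿ e^{-t²}`. -/
def hermiteFunction (n : ℕ) (t : ℝ) : ℝ :=
  ((2 : ℝ) ^ n * (Nat.factorial n : ℝ) * Real.sqrt Real.pi) ^ (-(1 / 2) : ℝ) * (-1) ^ n *
    Real.exp (t ^ 2 / 2) * iteratedDeriv n (fun s : ℝ => Real.exp (-s ^ 2)) t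

theorem exists_iteratedDeriv_exp_neg_sq (n : ℕ) :
    ∃ p : Polynomial ℝ, iteratedDeriv n (fun s : ℝ => Real.exp (-s ^ 2)) =
      fun t => p.eval t * Real.exp (-t ^ 2) := by
  induction n with
  | zero => exact ⟨1, by simp⟩
  | succ n ih =>
    obtain ⟨p, hp⟩ := ih
    refine ⟨Polynomial.derivative p - 2 * Polynomial.X * p, ?_⟩
    rw [iteratedDeriv_succ, hp]
    funext t
    have h1 : HasDerivAt (fun s : ℝ => Real.exp (-s ^ 2))
        (Real.exp (-t ^ 2) * (-(2 * t))) t := by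
      have := ((hasDerivAt_pow 2 t).neg).exp
      simpa using this
    have h2 := (p.hasDerivAt t).mul h1
    refine h2.deriv.trans ?_
    simp only [Polynomial.eval_sub, Polynomial.eval_mul, Polynomial.eval_X, Polynomial.eval_ofNat]
    ring

theorem exists_hermiteFunction_eq (n : ℕ) :
    ∃ p : Polynomial ℝ, ∀ t, hermiteFunction n t = p.eval t * Real.exp (-(1 / 2) * t ^ 2) := by
  obtain ⟨p, hp⟩ := exists_iteratedDeriv_exp_neg_sq n
  refine ⟨Polynomial.C (((2 : ℝ) ^ n * (Nat.factorial n : ℝ) * Real.sqrt Real.pi) ^ (-(1 / 2) : ℝ)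
    * (-1) ^ n) * p, fun t => ?_⟩
  have h : Real.exp (t ^ 2 / 2) * Real.exp (-t ^ 2) = Real.exp (-(1 / 2) * t ^ 2) := by
    rw [← Real.exp_add]; congr 1; ring
  rw [hermiteFunction, hp, ← h, Polynomial.eval_mul, Polynomial.eval_C]
  ring

theorem integrable_polynomial_mul_exp_neg_sq (p : Polynomial ℝ) :
    Integrable (fun t : ℝ => p.eval t * Real.exp (-1 * t ^ 2)) := by
  induction p using Polynomial.induction_on' with
  | add p q hp hq =>
    refine (hp.add hq).congr (Eventually.of_forall fun t => ?_)
    simp only [Pi.add_apply, Polynomial.eval_add, add_mul]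
  | monomial k a =>
    have h := (integrable_rpow_mul_exp_neg_mul_sq (b := 1) one_pos (s := (k : ℝ))
      (by have : (0 : ℝ) ≤ k := k.cast_nonneg
          linarith)).const_mul a
    simpa [Real.rpow_natCast, mul_assoc] using h

theorem memLp_hermiteFunction (n : ℕ) :
    MemLp (fun t : ℝ => (hermiteFunction n t : ℂ)) 2 volume := by
  obtain ⟨p, hp⟩ := exists_hermiteFunction_eq n
  have hc : Continuous (fun t : ℝ => (hermiteFunction n t : ℂ)) := by
    simp only [hp]
    exact Complex.continuous_ofReal.comp
      (p.continuous.mul (Real.continuous_exp.comp (by fun_prop)))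
  rw [memLp_two_iff_integrable_sq_norm hc.aestronglyMeasurable]
  refine (integrable_polynomial_mul_exp_neg_sq (p ^ 2)).congr (Eventually.of_forall fun t => ?_)
  have h : Real.exp (-1 * t ^ 2) = Real.exp (-(1 / 2) * t ^ 2) ^ 2 := by
    rw [← Real.exp_nat_mul]; congr 1; push_cast; ring
  simp only [Complex.norm_real, Real.norm_eq_abs, sq_abs, hp, h, Polynomial.eval_pow]
  ring

/-- The Hermite basis `(h_n)_{n ≥ 1}` of `L²(ℝ)`: `h_n` is the class of the Hermite function
of index `n - 1`. -/
def hermiteBasis (n : ℕ+) : L2R :=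
  (memLp_hermiteFunction ((n : ℕ) - 1)).toLp (fun t : ℝ => (hermiteFunction ((n : ℕ) - 1) t : ℂ))

/-! ### Slowly varying functions, dilations and quasiasymptotics at infinity -/

/-- `L` is slowly varying at infinity: for some `A > 0` it is measurable and positive on `[A, ∞)`,
and `L (a x) / L x → 1` as `x → ∞`, for each `a > 0`. The values of `L` outside `[A, ∞)` are
irrelevant. -/
def IsSlowlyVaryingAtInfinity (L : ℝ → ℝ) : Prop :=
  (∃ A > (0 : ℝ), Measurable (fun x : Set.Ici A => L x) ∧ ∀ x ≥ A, 0 < L x) ∧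
  ∀ a > (0 : ℝ), Tendsto (fun x => L (a * x) / L x) atTop (𝓝 1)

/-- The dilation `φ ↦ φ(a ·)` of Schwartz functions, `a ≠ 0` (zero if `a = 0`). -/
def dilateSchwartz (a : ℝ) : 𝓢(ℝ, ℂ) →L[ℂ] 𝓢(ℝ, ℂ) :=
  if h : a ≠ 0 then
    SchwartzMap.compCLMOfContinuousLinearEquiv ℂ
      (ContinuousLinearEquiv.unitsEquivAut ℝ (Units.mk0 a h))
  else 0

theorem dilateSchwartz_apply {a : ℝ} (ha : a ≠ 0) (φ : 𝓢(ℝ, ℂ)) (x : ℝ) :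
    dilateSchwartz a φ x = φ (a * x) := by
  simp [dilateSchwartz, ha, mul_comm]

/-- The dilation `f(a ·)` of a tempered distribution, `a ≠ 0`:
`⟨f(a ·), φ⟩ = |a|⁻¹ ⟨f, φ(· / a)⟩`. -/
def dilateDistribution (a : ℝ) (f : 𝓢'(ℝ, ℂ)) : 𝓢'(ℝ, ℂ) :=
  ((|a|⁻¹ : ℝ) : ℂ) • PointwiseConvergenceCLM.precomp ℂ (dilateSchwartz a⁻¹) f

theorem dilateDistribution_apply (a : ℝ) (f : 𝓢'(ℝ, ℂ)) (φ : 𝓢(ℝ, ℂ)) :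
    dilateDistribution a f φ = ((|a|⁻¹ : ℝ) : ℂ) * f (dilateSchwartz a⁻¹ φ) := rfl

/-- `f(l x) ~ l^α L(l) g(x)` as `l → ∞` in `𝓢'(ℝ)`: for each Schwartz function `φ`,
`⟨f(l ·) / (l^α L(l)), φ⟩ → ⟨g, φ⟩` as `l → ∞`. -/
def IsQuasiasymptoticAtInfinity (f g : 𝓢'(ℝ, ℂ)) (α : ℝ) (L : ℝ → ℝ) : Prop :=
  ∀ φ : 𝓢(ℝ, ℂ), Tendsto
    (fun l : ℝ => dilateDistribution l f φ / ((l ^ α * L l : ℝ) : ℂ)) atTop (𝓝 (g φ))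

end

/-!
The Hermite functions identify the Schwartz space with the space of rapidly decreasing sequences,
and a frame that is localized with respect to them does nearly the same: every Schwartz function
`φ` has an expansion `φ = ∑ c n • e n` converging in the Schwartz space with rapidly decreasing
coefficients, while every continuous seminorm grows at most polynomially along the `e n`
(`hasPolynomialGrowth_of_hasOffDiagonalDecay`). Both implications follow from these two facts.

If the normalized dilations `F l` of `f` converge on each `e n` and are bounded by a power of `n`,
dominated convergence in `F l φ = ∑ c n * F l (e n)` gives pointwise convergence
(`exists_tendsto_of_tendsto_on_frame`), and the limit is continuous because the Schwartz space is
complete, hence barrelled. Conversely, suppose that the `F l` converge pointwise but satisfy no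
bound of this kind. Then there are `l k → ∞` and `n k` with `F (l k) (e (n k))` larger than
`k * (n k) ^ k`, whereas by Banach–Steinhaus the sequence `F (l k)` is dominated by one continuous
seminorm, which grows polynomially along the `e n` (`exists_polynomial_bound_of_tendsto`). The
choice of a sequence `l k → ∞` makes any local control of the dilations unnecessary.

The expansion comes from the frame operator `T† T`, where `T` is the analysis operator: with
`T† T z = φ` one has `φ = ∑ (T z) n • e n`. That `T z` is rapidly decreasing is a special case of
the invariance of localized operators under inversion (Jaffard, Gröchenig), for which there is a
short argument (`isRapidlyDecreasing_of_normal_equation`). Conjugating `T` with the weight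
`(1 + δ * min n R) ^ K` changes it by an operator of norm `O(δ)`, uniformly in `R`, by Schur's test
and the off-diagonal decay. So for small `δ` the conjugated frame operator is still bounded below,
which bounds the weighted norm of the solution by that of the data, independently of `R`.

For the Hermite functions the ladder operators `x ∓ d/dx` yield orthonormality, the rapid decrease
of the coefficients of a Schwartz function and, with a one-dimensional Sobolev inequality, the
polynomial growth of the seminorms. Their completeness in `L²(ℝ)` is proved with the Fourier
transform.
-/

noncomputable section

/-! ### Schwartz space as a Fréchet space -/

theorem iteratedDeriv_eq_derivCLM_iterate (l : ℕ) (φ : 𝓢(ℝ, ℂ)) :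
    iteratedDeriv l φ = ((SchwartzMap.derivCLM ℂ ℂ) ^ l) φ := by
  induction l generalizing φ with
  | zero => simp
  | succ l ih =>
    rw [iteratedDeriv_succ', pow_succ, mul_apply_eq_comp, ← ih]
    rfl

theorem exists_seminorm_sub_lt_of_cauchySeq {u : ℕ → 𝓢(ℝ, ℂ)} (hu : CauchySeq u) (k l : ℕ) {ε : ℝ}
    (hε : 0 < ε) : ∃ N, ∀ n ≥ N, ∀ m ≥ N, SchwartzMap.seminorm ℂ k l (u n - u m) < ε := by
  have hc : Continuous (SchwartzMap.seminorm ℂ k l : 𝓢(ℝ, ℂ) → ℝ) :=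
    (schwartz_withSeminorms ℂ ℝ ℂ).continuous_seminorm (k, l)
  have hs : {φ : 𝓢(ℝ, ℂ) | SchwartzMap.seminorm ℂ k l φ < ε} ∈ 𝓝 (0 : 𝓢(ℝ, ℂ)) :=
    (isOpen_lt hc continuous_const).mem_nhds (by simpa using hε)
  have hu' := cauchySeq_iff_tendsto.1 hu
  rw [uniformity_eq_comap_nhds_zero_swapped, tendsto_comap_iff] at hu'
  obtain ⟨N, hN⟩ := eventually_atTop_prod_self.1 (hu' hs)
  exact ⟨N, fun n hn m hm => hN n m hn hm⟩

/-- The Schwartz space is complete: along a Cauchy sequence all derivatives converge uniformly,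
and the decay bounds pass to the limit. -/
instance completeSpace_schwartz : CompleteSpace 𝓢(ℝ, ℂ) := by
  have : (uniformity 𝓢(ℝ, ℂ)).IsCountablyGenerated :=
    IsUniformAddGroup.uniformity_countably_generated
  refine UniformSpace.complete_of_cauchySeq_tendsto fun u hu => ?_
  let T (l : ℕ) : 𝓢(ℝ, ℂ) →L[ℂ] BoundedContinuousFunction ℝ ℂ :=
    (SchwartzMap.toBoundedContinuousFunctionCLM ℂ ℝ ℂ).comp ((SchwartzMap.derivCLM ℂ ℂ) ^ l)
  have hT (l : ℕ) (φ : 𝓢(ℝ, ℂ)) (x : ℝ) : T l φ x = iteratedDeriv l φ x := by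
    rw [iteratedDeriv_eq_derivCLM_iterate]; rfl
  have hlim (l : ℕ) : ∃ G : BoundedContinuousFunction ℝ ℂ,
      Tendsto (fun n => T l (u n)) atTop (𝓝 G) :=
    cauchySeq_tendsto_of_complete ((T l).uniformContinuous.comp_cauchySeq hu)
  choose G hG using hlim
  have hGp (l : ℕ) (x : ℝ) :
      Tendsto (fun n => iteratedDeriv l (u n) x) atTop (𝓝 (G l x)) := by
    have h := ((BoundedContinuousFunction.tendsto_iff_tendstoUniformly.1 (hG l)).tendsto_at x)
    simpa only [hT] using h
  have hder (l : ℕ) (x : ℝ) : HasDerivAt (G l) (G (l + 1) x) x := by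
    refine hasDerivAt_of_tendstoUniformly
      (BoundedContinuousFunction.tendsto_iff_tendstoUniformly.1 (hG (l + 1)))
      (f := fun n => iteratedDeriv l (u n)) (Eventually.of_forall fun n y => ?_) (hGp l) x
    rw [hT, iteratedDeriv_succ, hasDerivAt_deriv_iff]
    exact ((u n).smooth ⊤).differentiable_iteratedDeriv l (by exact_mod_cast ENat.natCast_lt_top l) y
  have hit (l : ℕ) : iteratedDeriv l (G 0) = G l := by
    induction l with
    | zero => simp
    | succ l ih =>
      rw [iteratedDeriv_succ, ih]
      exact funext fun x => (hder l x).deriv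
  have hbound (k l : ℕ) {ε : ℝ} (hε : 0 < ε) : ∃ N, ∀ n ≥ N, ∀ x : ℝ,
      |x| ^ k * ‖iteratedDeriv l (u n) x - G l x‖ ≤ ε := by
    obtain ⟨N, hN⟩ := exists_seminorm_sub_lt_of_cauchySeq hu k l hε
    refine ⟨N, fun n hn x => ?_⟩
    have h1 : Tendsto (fun m => |x| ^ k * ‖iteratedDeriv l (u n) x - iteratedDeriv l (u m) x‖)
        atTop (𝓝 (|x| ^ k * ‖iteratedDeriv l (u n) x - G l x‖)) :=
      ((tendsto_const_nhds.sub (hGp l x)).norm).const_mul _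
    refine le_of_tendsto h1 ((eventually_ge_atTop N).mono fun m hm => ?_)
    have h2 := SchwartzMap.le_seminorm' ℂ k l (u n - u m) x
    rw [iteratedDeriv_eq_derivCLM_iterate, map_sub] at h2
    simp only [sub_apply, ← iteratedDeriv_eq_derivCLM_iterate] at h2
    exact h2.trans (hN n hn m hm).le
  let g : 𝓢(ℝ, ℂ) :=
    { toFun := G 0
      smooth' := by
        refine contDiff_of_differentiable_iteratedDeriv fun l _ => ?_
        rw [hit]
        exact fun x => (hder l x).differentiableAt
      decay' := by
        intro k l
        obtain ⟨N, hN⟩ := hbound k l one_pos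
        refine ⟨SchwartzMap.seminorm ℂ k l (u N) + 1, fun x => ?_⟩
        rw [norm_iteratedFDeriv_eq_norm_iteratedDeriv, hit, Real.norm_eq_abs]
        calc |x| ^ k * ‖G l x‖
            ≤ |x| ^ k * (‖iteratedDeriv l (u N) x‖ + ‖iteratedDeriv l (u N) x - G l x‖) := by
              gcongr
              rw [← norm_neg (iteratedDeriv l (u N) x - G l x), neg_sub]
              exact norm_le_norm_add_norm_sub' _ _
          _ ≤ _ := by
              rw [mul_add]
              exact add_le_add (SchwartzMap.le_seminorm' ℂ k l (u N) x) (hN N le_rfl x) }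
  refine ⟨g, ((schwartz_withSeminorms ℂ ℝ ℂ).tendsto_nhds_atTop u g).2 fun ⟨k, l⟩ ε hε => ?_⟩
  obtain ⟨N, hN⟩ := hbound k l (half_pos hε)
  refine ⟨N, fun n hn => lt_of_le_of_lt ?_ (half_lt_self hε)⟩
  refine SchwartzMap.seminorm_le_bound' ℂ k l _ (half_pos hε).le fun x => ?_
  have h3 : iteratedDeriv l g = G l := hit l
  rw [iteratedDeriv_eq_derivCLM_iterate, map_sub]
  simp only [sub_apply, ← iteratedDeriv_eq_derivCLM_iterate, h3]
  exact hN n hn x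

instance baireSpace_schwartz : BaireSpace 𝓢(ℝ, ℂ) := by
  have : (uniformity 𝓢(ℝ, ℂ)).IsCountablyGenerated :=
    IsUniformAddGroup.uniformity_countably_generated
  infer_instance

/-- Banach–Steinhaus on the Schwartz space, with the equicontinuity expressed by a seminorm. -/
theorem exists_seminorm_bound_of_pointwise_bounded {ι : Type*} (F : ι → 𝓢(ℝ, ℂ) →L[ℂ] ℂ)
    (hF : ∀ φ, ∃ C, ∀ i, ‖F i φ‖ ≤ C) :
    ∃ p : Seminorm ℂ 𝓢(ℝ, ℂ), Continuous p ∧ ∀ i φ, ‖F i φ‖ ≤ p φ := by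
  have h := (norm_withSeminorms ℂ ℂ).banach_steinhaus (𝓕 := F) (fun _ φ => by
    obtain ⟨C, hC⟩ := hF φ
    exact ⟨C, by rintro _ ⟨i, rfl⟩; exact hC i⟩)
  obtain ⟨p, hp, hpF⟩ :=
    ((norm_withSeminorms ℂ ℂ).uniformEquicontinuous_iff_exists_continuous_seminorm
      (fun i => (F i).toLinearMap)).1 h 0
  exact ⟨p, hp, fun i φ => hpF i φ⟩

/-- A series of Schwartz functions that converges absolutely for every Schwartz seminorm converges
in the Schwartz space. -/
theorem summable_schwartz_of_summable_seminorm {ι : Type*} {v : ι → 𝓢(ℝ, ℂ)}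
    (h : ∀ k l, Summable fun n => SchwartzMap.seminorm ℂ k l (v n)) : Summable v := by
  rw [summable_iff_vanishing]
  intro U hU
  obtain ⟨s, ε, hε, hsU⟩ := ((schwartz_withSeminorms ℂ ℝ ℂ).mem_nhds_iff 0 U).1 hU
  have hsum : Summable fun n => ∑ i ∈ s, SchwartzMap.seminorm ℂ i.1 i.2 (v n) :=
    summable_sum fun i _ => h i.1 i.2
  obtain ⟨t₀, ht₀⟩ := summable_iff_vanishing_norm.1 hsum ε hε
  refine ⟨t₀, fun t ht => hsU ?_⟩
  rw [Seminorm.mem_ball, sub_zero]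
  refine Seminorm.finset_sup_apply_lt hε fun i hi => ?_
  refine lt_of_le_of_lt ?_ (ht₀ t ht)
  calc schwartzSeminormFamily ℂ ℝ ℂ i (∑ n ∈ t, v n)
      ≤ ∑ n ∈ t, SchwartzMap.seminorm ℂ i.1 i.2 (v n) :=
        Finset.le_sum_of_subadditive _ (map_zero _).le (map_add_le_add _) _ _
    _ ≤ ∑ n ∈ t, ∑ i ∈ s, SchwartzMap.seminorm ℂ i.1 i.2 (v n) :=
        Finset.sum_le_sum fun n _ => Finset.single_le_sum
          (f := fun i : ℕ × ℕ => SchwartzMap.seminorm ℂ i.1 i.2 (v n))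
          (fun _ _ => apply_nonneg _ _) hi
    _ ≤ _ := Real.le_norm_self _

/-- Under absolute convergence for every seminorm, the sum in the Schwartz space is identified by its
class in `L²(ℝ)`. -/
theorem hasSum_schwartz_of_hasSum_toLp {ι : Type*} {v : ι → 𝓢(ℝ, ℂ)} {φ : 𝓢(ℝ, ℂ)}
    (h : ∀ k l, Summable fun n => SchwartzMap.seminorm ℂ k l (v n))
    (hφ : HasSum (fun n => ((v n).toLp 2 : L2R)) (φ.toLp 2)) : HasSum v φ := by
  obtain ⟨ψ, hψ⟩ := summable_schwartz_of_summable_seminorm h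
  have h1 : HasSum (fun n => ((v n).toLp 2 : L2R)) (ψ.toLp 2) :=
    hψ.mapL (SchwartzMap.toLpCLM ℂ ℂ 2 (volume : Measure ℝ))
  rwa [SchwartzMap.injective_toLp (μ := volume) 2 (h1.unique hφ)] at hψ

/-! ### Hermite functions as Schwartz functions -/

theorem exists_abs_polynomial_mul_gaussian_le (p : Polynomial ℝ) :
    ∃ C : ℝ, ∀ t : ℝ, |p.eval t * Real.exp (-(t ^ 2 / 2))| ≤ C := by
  induction p using Polynomial.induction_on' with
  | add p q hp hq =>
    obtain ⟨C, hC⟩ := hp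
    obtain ⟨C', hC'⟩ := hq
    refine ⟨C + C', fun t => ?_⟩
    rw [Polynomial.eval_add, add_mul]
    exact (abs_add_le _ _).trans (add_le_add (hC t) (hC' t))
  | monomial k a =>
    refine ⟨|a| * (1 + 2 ^ k * (k.factorial : ℝ)), fun t => ?_⟩
    rw [Polynomial.eval_monomial, abs_mul, abs_mul, abs_pow, Real.abs_exp, mul_assoc]
    gcongr
    have h0 : 0 ≤ t ^ 2 / 2 := by positivity
    have h1 : |t| ^ k ≤ 1 + (t ^ 2) ^ k := by
      rcases le_total |t| 1 with h | h
      · exact (pow_le_one₀ (abs_nonneg t) h).trans (by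
          have : 0 ≤ (t ^ 2) ^ k := by positivity
          linarith)
      · have : |t| ^ k ≤ (|t| ^ 2) ^ k := by
          gcongr
          nlinarith
        rw [sq_abs] at this
        linarith
    have h2 : (t ^ 2) ^ k ≤ 2 ^ k * (k.factorial : ℝ) * Real.exp (t ^ 2 / 2) := by
      have := Real.pow_div_factorial_le_exp _ h0 k
      rw [div_le_iff₀ (by positivity), div_pow, div_le_iff₀ (by positivity)] at this
      linarith
    have h3 : Real.exp (-(t ^ 2 / 2)) ≤ 1 := Real.exp_le_one_iff.2 (by linarith)
    calc |t| ^ k * Real.exp (-(t ^ 2 / 2))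
        ≤ (1 + 2 ^ k * (k.factorial : ℝ) * Real.exp (t ^ 2 / 2)) * Real.exp (-(t ^ 2 / 2)) := by
          gcongr
          linarith
      _ = Real.exp (-(t ^ 2 / 2)) + 2 ^ k * (k.factorial : ℝ) := by
          rw [add_mul, mul_assoc, ← Real.exp_add]
          simp
      _ ≤ _ := by linarith

theorem exists_iteratedDeriv_gaussian (n : ℕ) :
    ∃ p : Polynomial ℝ, iteratedDeriv n (fun t : ℝ => (Real.exp (-(t ^ 2 / 2)) : ℂ)) =
      fun t => ((p.eval t * Real.exp (-(t ^ 2 / 2)) : ℝ) : ℂ) := by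
  induction n with
  | zero => exact ⟨1, by simp⟩
  | succ n ih =>
    obtain ⟨p, hp⟩ := ih
    refine ⟨Polynomial.derivative p - Polynomial.X * p, ?_⟩
    rw [iteratedDeriv_succ, hp]
    funext t
    have h1 : HasDerivAt (fun s : ℝ => Real.exp (-(s ^ 2 / 2)))
        (Real.exp (-(t ^ 2 / 2)) * (-t)) t := by
      have := (((hasDerivAt_pow 2 t).div_const 2).neg).exp
      simpa using this
    have h2 := ((p.hasDerivAt t).mul h1).ofReal_comp
    refine h2.deriv.trans ?_
    simp only [Polynomial.eval_sub, Polynomial.eval_mul, Polynomial.eval_X]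
    congr 1
    ring

/-- The Gaussian `exp (-t² / 2)`. -/
def schwartzGaussian : 𝓢(ℝ, ℂ) where
  toFun := fun t : ℝ => (Real.exp (-(t ^ 2 / 2)) : ℂ)
  smooth' := Complex.ofRealCLM.contDiff.comp (by fun_prop : ContDiff ℝ _ fun t : ℝ =>
    Real.exp (-(t ^ 2 / 2)))
  decay' := by
    intro k n
    obtain ⟨p, hp⟩ := exists_iteratedDeriv_gaussian n
    obtain ⟨C, hC⟩ := exists_abs_polynomial_mul_gaussian_le (Polynomial.X ^ k * p)
    refine ⟨C, fun t => le_trans (le_of_eq ?_) (hC t)⟩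
    rw [norm_iteratedFDeriv_eq_norm_iteratedDeriv, hp]
    rw [Complex.norm_real, Real.norm_eq_abs, Real.norm_eq_abs, Polynomial.eval_mul,
      Polynomial.eval_pow, Polynomial.eval_X, mul_assoc, abs_mul (t ^ k), abs_pow]

theorem schwartzGaussian_apply (t : ℝ) : schwartzGaussian t = (Real.exp (-(t ^ 2 / 2)) : ℂ) := rfl

/-- Multiplication by the variable, on Schwartz functions. -/
def mulX : 𝓢(ℝ, ℂ) →L[ℂ] 𝓢(ℝ, ℂ) := SchwartzMap.smulLeftCLM ℂ (fun x : ℝ => (x : ℂ))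

theorem mulX_apply (φ : 𝓢(ℝ, ℂ)) (x : ℝ) : mulX φ x = x * φ x := by
  have h : (fun x : ℝ => (x : ℂ)).HasTemperateGrowth := Complex.ofRealCLM.hasTemperateGrowth
  rw [mulX, SchwartzMap.smulLeftCLM_apply_apply h, smul_eq_mul]

theorem mulX_pow_apply (k : ℕ) (φ : 𝓢(ℝ, ℂ)) (x : ℝ) : (mulX ^ k) φ x = x ^ k * φ x := by
  induction k with
  | zero => simp
  | succ k ih => rw [pow_succ', mul_apply_eq_comp, mulX_apply, ih]; ring

/-- The creation operator `φ ↦ x φ - φ'`. -/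
def raising : 𝓢(ℝ, ℂ) →L[ℂ] 𝓢(ℝ, ℂ) := mulX - SchwartzMap.derivCLM ℂ ℂ

/-- The annihilation operator `φ ↦ x φ + φ'`. -/
def lowering : 𝓢(ℝ, ℂ) →L[ℂ] 𝓢(ℝ, ℂ) := mulX + SchwartzMap.derivCLM ℂ ℂ

theorem raising_apply (φ : 𝓢(ℝ, ℂ)) (x : ℝ) : raising φ x = x * φ x - deriv φ x := by
  rw [← mulX_apply]; rfl

theorem lowering_apply (φ : 𝓢(ℝ, ℂ)) (x : ℝ) : lowering φ x = x * φ x + deriv φ x := by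
  rw [← mulX_apply]; rfl

theorem mulX_eq (φ : 𝓢(ℝ, ℂ)) : mulX φ = (1 / 2 : ℂ) • (raising φ + lowering φ) := by
  ext x
  simp only [smul_apply, add_apply, raising_apply, lowering_apply, mulX_apply, smul_eq_mul]
  ring

theorem derivCLM_eq (φ : 𝓢(ℝ, ℂ)) :
    SchwartzMap.derivCLM ℂ ℂ φ = (1 / 2 : ℂ) • (lowering φ - raising φ) := by
  ext x
  simp only [smul_apply, sub_apply, raising_apply, lowering_apply, SchwartzMap.derivCLM_apply,
    smul_eq_mul]
  ring

theorem derivCLM_mulX (φ : 𝓢(ℝ, ℂ)) :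
    SchwartzMap.derivCLM ℂ ℂ (mulX φ) = φ + mulX (SchwartzMap.derivCLM ℂ ℂ φ) := by
  ext x
  rw [SchwartzMap.derivCLM_apply, add_apply, mulX_apply, SchwartzMap.derivCLM_apply]
  have h : HasDerivAt (fun y : ℝ => (y : ℂ) * φ y) (1 * φ x + x * deriv φ x) x :=
    (hasDerivAt_id x).ofReal_comp.mul (φ.hasDerivAt x)
  have h' : (mulX φ : ℝ → ℂ) = fun y : ℝ => (y : ℂ) * φ y := funext (mulX_apply φ)
  rw [h', h.deriv, one_mul]

theorem lowering_raising (φ : 𝓢(ℝ, ℂ)) :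
    lowering (raising φ) = raising (lowering φ) + (2 : ℂ) • φ := by
  simp only [lowering, raising, _root_.add_apply, _root_.sub_apply, map_sub, map_add, derivCLM_mulX]
  module

/-- The Hermite functions without the normalizing factor. -/
def hermiteUnnormalized : ℕ → 𝓢(ℝ, ℂ)
  | 0 => schwartzGaussian
  | n + 1 => raising (hermiteUnnormalized n)

theorem hermiteUnnormalized_zero : hermiteUnnormalized 0 = schwartzGaussian := rfl

theorem hermiteUnnormalized_succ (n : ℕ) :
    hermiteUnnormalized (n + 1) = raising (hermiteUnnormalized n) := rfl

theorem hermiteUnnormalized_apply (n : ℕ) (t : ℝ) : hermiteUnnormalized n t =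
    (((-1) ^ n * Real.exp (t ^ 2 / 2) *
      iteratedDeriv n (fun s : ℝ => Real.exp (-s ^ 2)) t : ℝ) : ℂ) := by
  induction n generalizing t with
  | zero =>
    rw [hermiteUnnormalized, schwartzGaussian_apply, iteratedDeriv_zero, pow_zero, one_mul,
      ← Real.exp_add]
    congr 2
    ring
  | succ n ih =>
    rw [hermiteUnnormalized, raising_apply]
    have h0 : HasDerivAt (iteratedDeriv n (fun s : ℝ => Real.exp (-s ^ 2)))
        (iteratedDeriv (n + 1) (fun s : ℝ => Real.exp (-s ^ 2)) t) t := by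
      rw [iteratedDeriv_succ, hasDerivAt_deriv_iff]
      have : ContDiff ℝ (⊤ : ℕ∞) fun s : ℝ => Real.exp (-s ^ 2) := by fun_prop
      exact this.differentiable_iteratedDeriv n (by exact_mod_cast ENat.natCast_lt_top n) t
    have h1 : HasDerivAt (fun s : ℝ => Real.exp (s ^ 2 / 2)) (Real.exp (t ^ 2 / 2) * t) t := by
      have := ((hasDerivAt_pow 2 t).div_const 2).exp
      simpa using this
    have h2 := ((h1.const_mul ((-1 : ℝ) ^ n)).fun_mul h0).ofReal_comp
    have h3 : (hermiteUnnormalized n : ℝ → ℂ) = _ := funext ih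
    rw [h3, h2.deriv]
    push_cast
    ring

theorem lowering_schwartzGaussian : lowering schwartzGaussian = 0 := by
  ext t
  rw [lowering_apply, zero_apply]
  have h1 : HasDerivAt (fun s : ℝ => Real.exp (-(s ^ 2 / 2)))
      (Real.exp (-(t ^ 2 / 2)) * (-t)) t := by
    have := (((hasDerivAt_pow 2 t).div_const 2).neg).exp
    simpa using this
  have h2 : (schwartzGaussian : ℝ → ℂ) = fun t : ℝ => ((Real.exp (-(t ^ 2 / 2)) : ℝ) : ℂ) := rfl
  rw [h2, h1.ofReal_comp.deriv]
  push_cast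
  ring

theorem lowering_hermiteUnnormalized_succ (n : ℕ) : lowering (hermiteUnnormalized (n + 1)) =
    (2 * (n + 1) : ℂ) • hermiteUnnormalized n := by
  rw [hermiteUnnormalized, lowering_raising]
  induction n with
  | zero => rw [hermiteUnnormalized, lowering_schwartzGaussian]; simp
  | succ n ih =>
    nth_rw 1 [hermiteUnnormalized]
    rw [lowering_raising, ih, map_smul, ← hermiteUnnormalized]
    push_cast
    module

/-! ### Adjoint relations and orthonormality -/

/-- The embedding of Schwartz functions into `L²(ℝ)`. -/
abbrev schwartzToL2 : 𝓢(ℝ, ℂ) →L[ℂ] L2R := SchwartzMap.toLpCLM ℂ ℂ 2 (volume : Measure ℝ)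

theorem inner_schwartzToL2 (φ ψ : 𝓢(ℝ, ℂ)) :
    inner ℂ (schwartzToL2 φ) (schwartzToL2 ψ) = ∫ x, (starRingEnd ℂ) (φ x) * ψ x := by
  refine (SchwartzMap.inner_toL2_toL2_eq φ ψ).trans ?_
  simp only [RCLike.inner_apply, mul_comm]

theorem inner_mulX_left (φ ψ : 𝓢(ℝ, ℂ)) : inner ℂ (schwartzToL2 (mulX φ)) (schwartzToL2 ψ) =
    inner ℂ (schwartzToL2 φ) (schwartzToL2 (mulX ψ)) := by
  simp only [inner_schwartzToL2, mulX_apply, map_mul, Complex.conj_ofReal]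
  congr 1
  ext x
  ring

theorem inner_derivCLM_left (φ ψ : 𝓢(ℝ, ℂ)) :
    inner ℂ (schwartzToL2 (SchwartzMap.derivCLM ℂ ℂ φ)) (schwartzToL2 ψ) =
      -inner ℂ (schwartzToL2 φ) (schwartzToL2 (SchwartzMap.derivCLM ℂ ℂ ψ)) := by
  have h := SchwartzMap.integral_bilinear_deriv_right_eq_neg_left φ ψ
    ((ContinuousLinearMap.mul ℝ ℂ).comp (Complex.conjCLE : ℂ →L[ℝ] ℂ))
  simp only [inner_schwartzToL2, SchwartzMap.derivCLM_apply]
  simpa [eq_neg_iff_add_eq_zero, add_comm] using h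

theorem inner_raising_left (φ ψ : 𝓢(ℝ, ℂ)) :
    inner ℂ (schwartzToL2 (raising φ)) (schwartzToL2 ψ) =
      inner ℂ (schwartzToL2 φ) (schwartzToL2 (lowering ψ)) := by
  rw [raising, lowering, _root_.sub_apply, _root_.add_apply, map_sub, map_add, inner_sub_left,
    inner_add_right, inner_mulX_left, inner_derivCLM_left, sub_neg_eq_add]

theorem inner_lowering_left (φ ψ : 𝓢(ℝ, ℂ)) :
    inner ℂ (schwartzToL2 (lowering φ)) (schwartzToL2 ψ) =
      inner ℂ (schwartzToL2 φ) (schwartzToL2 (raising ψ)) := by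
  rw [raising, lowering, _root_.sub_apply, _root_.add_apply, map_sub, map_add, inner_sub_right,
    inner_add_left, inner_mulX_left, inner_derivCLM_left, sub_eq_add_neg]

theorem inner_schwartzGaussian_self :
    inner ℂ (schwartzToL2 schwartzGaussian) (schwartzToL2 schwartzGaussian) =
      (Real.sqrt Real.pi : ℂ) := by
  rw [inner_schwartzToL2]
  have h := integral_gaussian 1
  rw [div_one] at h
  rw [← h, ← integral_complex_ofReal]
  congr 1
  ext x
  rw [schwartzGaussian_apply, Complex.conj_ofReal, ← Complex.ofReal_mul, ← Real.exp_add]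
  congr 2
  ring

theorem inner_hermiteUnnormalized (m n : ℕ) :
    inner ℂ (schwartzToL2 (hermiteUnnormalized m)) (schwartzToL2 (hermiteUnnormalized n)) =
      if m = n then ((2 ^ n * (n.factorial : ℝ) * Real.sqrt Real.pi : ℝ) : ℂ) else 0 := by
  induction n generalizing m with
  | zero =>
    cases m with
    | zero => simpa [hermiteUnnormalized] using inner_schwartzGaussian_self
    | succ m =>
      rw [hermiteUnnormalized_succ, inner_raising_left, hermiteUnnormalized_zero,
        lowering_schwartzGaussian]
      simp
  | succ n ih =>
    rw [hermiteUnnormalized_succ n, ← inner_lowering_left]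
    cases m with
    | zero =>
      rw [hermiteUnnormalized_zero, lowering_schwartzGaussian]
      simp
    | succ m =>
      rw [lowering_hermiteUnnormalized_succ, map_smul, inner_smul_left, ih]
      by_cases hmn : m = n
      · subst hmn
        simp only [map_mul, map_add, map_natCast, map_one, Nat.factorial_succ, pow_succ, if_true]
        rw [show (starRingEnd ℂ) 2 = 2 from map_ofNat _ 2]
        push_cast
        ring
      · simp [hmn]

/-- The normalizing factor of the Hermite function of index `n`. -/
def hermiteNormalization (n : ℕ) : ℝ :=
  ((2 : ℝ) ^ n * (Nat.factorial n : ℝ) * Real.sqrt Real.pi) ^ (-(1 / 2) : ℝ)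

theorem hermiteNormalization_pos (n : ℕ) : 0 < hermiteNormalization n := by
  have := Real.pi_pos
  unfold hermiteNormalization
  positivity

theorem hermiteNormalization_sq_mul (n : ℕ) : hermiteNormalization n ^ 2 *
    ((2 : ℝ) ^ n * (Nat.factorial n : ℝ) * Real.sqrt Real.pi) = 1 := by
  have hπ := Real.pi_pos
  have h : 0 < (2 : ℝ) ^ n * (Nat.factorial n : ℝ) * Real.sqrt Real.pi := by positivity
  rw [hermiteNormalization, ← Real.rpow_natCast, ← Real.rpow_mul h.le]
  norm_num
  rw [Real.rpow_neg_one]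
  field_simp

theorem hermiteNormalization_succ (n : ℕ) : hermiteNormalization n =
    hermiteNormalization (n + 1) * Real.sqrt (2 * (n + 1)) := by
  have h0 := hermiteNormalization_pos n
  have h1 := hermiteNormalization_pos (n + 1)
  have h2 := hermiteNormalization_sq_mul n
  have h3 := hermiteNormalization_sq_mul (n + 1)
  rw [← sq_eq_sq₀ h0.le (by positivity), mul_pow, Real.sq_sqrt (by positivity)]
  have hπ := Real.pi_pos
  have h : (2 : ℝ) ^ n * (Nat.factorial n : ℝ) * Real.sqrt Real.pi ≠ 0 := by positivity
  apply mul_right_cancel₀ h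
  rw [h2]
  refine h3.symm.trans ?_
  rw [Nat.factorial_succ]
  push_cast
  ring

/-- The Hermite function of index `n` (`n ≥ 0`), as a Schwartz function. -/
def hermiteSchwartz (n : ℕ) : 𝓢(ℝ, ℂ) := (hermiteNormalization n : ℂ) • hermiteUnnormalized n

theorem hermiteSchwartz_apply (n : ℕ) (t : ℝ) : hermiteSchwartz n t = (hermiteFunction n t : ℂ) := by
  rw [hermiteSchwartz, smul_apply, hermiteUnnormalized_apply, hermiteFunction,
    hermiteNormalization, smul_eq_mul, ← Complex.ofReal_mul]
  congr 1
  ring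

theorem hermiteBasis_eq (n : ℕ+) : hermiteBasis n = schwartzToL2 (hermiteSchwartz (n.natPred)) :=
  MemLp.toLp_congr _ (SchwartzMap.memLp _ 2 volume)
    (Eventually.of_forall fun t => (hermiteSchwartz_apply _ t).symm)

theorem orthonormal_hermiteSchwartz : Orthonormal ℂ fun n => schwartzToL2 (hermiteSchwartz n) := by
  rw [orthonormal_iff_ite]
  intro m n
  simp only [hermiteSchwartz, map_smul, inner_smul_left, inner_smul_right,
    inner_hermiteUnnormalized, Complex.conj_ofReal]
  split_ifs with h
  · subst h
    rw [← mul_assoc, ← sq]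
    exact_mod_cast hermiteNormalization_sq_mul m
  · simp

theorem raising_hermiteSchwartz (n : ℕ) : raising (hermiteSchwartz n) =
    (Real.sqrt (2 * (n + 1)) : ℂ) • hermiteSchwartz (n + 1) := by
  rw [hermiteSchwartz, hermiteSchwartz, map_smul, ← hermiteUnnormalized,
    hermiteNormalization_succ n, smul_smul]
  congr 1
  push_cast
  ring

theorem lowering_hermiteSchwartz_zero : lowering (hermiteSchwartz 0) = 0 := by
  rw [hermiteSchwartz, map_smul, hermiteUnnormalized, lowering_schwartzGaussian, smul_zero]

theorem lowering_hermiteSchwartz_succ (n : ℕ) : lowering (hermiteSchwartz (n + 1)) =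
    (Real.sqrt (2 * (n + 1)) : ℂ) • hermiteSchwartz n := by
  rw [hermiteSchwartz, hermiteSchwartz, map_smul, lowering_hermiteUnnormalized_succ,
    hermiteNormalization_succ n, smul_smul, smul_smul]
  congr 1
  have h : ((Real.sqrt (2 * (n + 1)) : ℝ) : ℂ) * (Real.sqrt (2 * (n + 1)) : ℝ) = 2 * (n + 1) := by
    rw [← Complex.ofReal_mul, Real.mul_self_sqrt (by positivity)]
    push_cast
    ring
  rw [Complex.ofReal_mul, ← h]
  ring

/-! ### Decay of Hermite coefficients, growth of Hermite functions -/

theorem lowering_raising_pow_hermiteSchwartz (K n : ℕ) :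
    ((lowering * raising) ^ K) (hermiteSchwartz n) =
      ((2 * (n + 1) : ℂ) ^ K) • hermiteSchwartz n := by
  induction K with
  | zero => simp
  | succ K ih =>
    rw [pow_succ', mul_apply_eq_comp, ih, map_smul, mul_apply_eq_comp, hermiteSchwartz, map_smul,
      map_smul, ← hermiteUnnormalized, lowering_hermiteUnnormalized_succ, smul_smul, smul_smul,
      smul_smul]
    congr 1
    ring

theorem inner_lowering_raising_pow_left (K : ℕ) (φ ψ : 𝓢(ℝ, ℂ)) :
    inner ℂ (schwartzToL2 (((lowering * raising) ^ K) φ)) (schwartzToL2 ψ) =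
      inner ℂ (schwartzToL2 φ) (schwartzToL2 (((lowering * raising) ^ K) ψ)) := by
  induction K generalizing φ ψ with
  | zero => simp
  | succ K ih =>
    have h : ((lowering * raising) ^ (K + 1)) ψ =
        lowering (raising (((lowering * raising) ^ K) ψ)) := by
      rw [pow_succ', mul_apply_eq_comp, mul_apply_eq_comp]
    rw [h, pow_succ, mul_apply_eq_comp, ih, mul_apply_eq_comp, inner_lowering_left,
      inner_raising_left]

/-- Hermite coefficients of Schwartz functions are rapidly decreasing, because the Hermite
functions are eigenfunctions of a symmetric differential operator. -/
theorem exists_norm_inner_hermiteSchwartz_le (φ : 𝓢(ℝ, ℂ)) (K : ℕ) : ∃ C : ℝ, ∀ n : ℕ,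
    ((n : ℝ) + 1) ^ K * ‖inner ℂ (schwartzToL2 (hermiteSchwartz n)) (schwartzToL2 φ)‖ ≤ C := by
  refine ⟨‖schwartzToL2 (((lowering * raising) ^ K) φ)‖, fun n => ?_⟩
  have h := inner_lowering_raising_pow_left K (hermiteSchwartz n) φ
  rw [lowering_raising_pow_hermiteSchwartz, map_smul, inner_smul_left] at h
  have h1 := norm_inner_le_norm (𝕜 := ℂ) (schwartzToL2 (hermiteSchwartz n))
    (schwartzToL2 (((lowering * raising) ^ K) φ))
  rw [← h, orthonormal_hermiteSchwartz.1 n, one_mul, norm_mul] at h1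
  refine le_trans ?_ h1
  gcongr
  have h2 : (2 * (n + 1) : ℂ) ^ K = (((2 * (n + 1)) ^ K : ℝ) : ℂ) := by push_cast; ring
  rw [h2, Complex.conj_ofReal, Complex.norm_real, Real.norm_of_nonneg (by positivity)]
  gcongr
  linarith [n.cast_nonneg (α := ℝ)]

theorem integrable_norm_sq_schwartz (φ : 𝓢(ℝ, ℂ)) : Integrable fun x => ‖φ x‖ ^ 2 :=
  (memLp_two_iff_integrable_sq_norm φ.continuous.aestronglyMeasurable).1 (φ.memLp 2 volume)

theorem integral_norm_sq_schwartz (φ : 𝓢(ℝ, ℂ)) : ∫ x, ‖φ x‖ ^ 2 = ‖schwartzToL2 φ‖ ^ 2 := by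
  have h := inner_schwartzToL2 φ φ
  rw [inner_self_eq_norm_sq_to_K] at h
  have h2 : ∀ x, (starRingEnd ℂ) (φ x) * φ x = ((‖φ x‖ ^ 2 : ℝ) : ℂ) := fun x => by
    rw [Complex.conj_mul']; norm_cast
  simp only [h2, integral_complex_ofReal] at h
  exact Complex.ofReal_injective (h.symm.trans (by push_cast; rfl))

/-- A one-dimensional Sobolev inequality. -/
theorem norm_schwartz_apply_le (φ : 𝓢(ℝ, ℂ)) (x : ℝ) :
    ‖φ x‖ ≤ ‖schwartzToL2 φ‖ + ‖schwartzToL2 (SchwartzMap.derivCLM ℂ ℂ φ)‖ := by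
  have hI : Integrable fun t => ‖φ t‖ ^ 2 + ‖SchwartzMap.derivCLM ℂ ℂ φ t‖ ^ 2 :=
    (integrable_norm_sq_schwartz φ).add
      (integrable_norm_sq_schwartz (SchwartzMap.derivCLM ℂ ℂ φ))
  have hle (t : ℝ) : ‖2 * inner ℝ (φ t) (deriv φ t)‖ ≤ ‖φ t‖ ^ 2 + ‖deriv φ t‖ ^ 2 := by
    have h1 := norm_inner_le_norm (𝕜 := ℝ) (φ t) (deriv φ t)
    rw [norm_mul, Real.norm_ofNat]
    nlinarith [sq_nonneg (‖φ t‖ - ‖deriv φ t‖)]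
  have hmeas : Continuous fun t => 2 * inner ℝ (φ t) (deriv φ t) :=
    continuous_const.mul (φ.continuous.inner (SchwartzMap.derivCLM ℂ ℂ φ).continuous)
  have hI' : Integrable fun t => 2 * inner ℝ (φ t) (deriv φ t) :=
    hI.mono' hmeas.aestronglyMeasurable (Eventually.of_forall hle)
  have hbot : Tendsto (fun t => ‖φ t‖ ^ 2) atBot (𝓝 0) := by
    have h := (φ.tendsto_cocompact.mono_left atBot_le_cocompact).norm.pow 2
    simpa using h
  -- `‖φ x‖² = ∫ t in Iic x, (‖φ t‖²)'`, and the integrand is at most `‖φ t‖² + ‖φ' t‖²`.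
  have hF := integral_Iic_of_hasDerivAt_of_tendsto' (a := x)
    (fun t _ => (φ.hasDerivAt t).norm_sq) hI'.integrableOn hbot
  rw [sub_zero] at hF
  have hsq : ‖φ x‖ ^ 2 ≤ ‖schwartzToL2 φ‖ ^ 2 + ‖schwartzToL2 (SchwartzMap.derivCLM ℂ ℂ φ)‖ ^ 2 := by
    rw [← integral_norm_sq_schwartz, ← integral_norm_sq_schwartz, ← integral_add
      (integrable_norm_sq_schwartz φ) (integrable_norm_sq_schwartz _), ← hF]
    calc _ ≤ ∫ t in Set.Iic x, (‖φ t‖ ^ 2 + ‖SchwartzMap.derivCLM ℂ ℂ φ t‖ ^ 2) :=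
          integral_mono hI'.integrableOn hI.integrableOn fun t =>
            (Real.le_norm_self _).trans (hle t)
      _ ≤ _ := setIntegral_le_integral hI (Eventually.of_forall fun t => by positivity)
  refine (sq_le_sq₀ (norm_nonneg _) (by positivity)).1 ?_
  nlinarith [norm_nonneg (schwartzToL2 φ), norm_nonneg (schwartzToL2 (SchwartzMap.derivCLM ℂ ℂ φ))]

/-- Polynomial growth of a seminorm along a sequence of Schwartz functions. -/
def HasPolynomialGrowth (v : ℕ → 𝓢(ℝ, ℂ)) (p : Seminorm ℂ 𝓢(ℝ, ℂ)) : Prop :=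
  ∃ C : ℝ, ∃ q : ℕ, ∀ n : ℕ, p (v n) ≤ C * ((n : ℝ) + 1) ^ q

namespace HasPolynomialGrowth

variable {v : ℕ → 𝓢(ℝ, ℂ)} {p p₁ p₂ : Seminorm ℂ 𝓢(ℝ, ℂ)}

theorem add (h₁ : HasPolynomialGrowth v p₁) (h₂ : HasPolynomialGrowth v p₂) :
    HasPolynomialGrowth v (p₁ + p₂) := by
  obtain ⟨C₁, q₁, h₁⟩ := h₁
  obtain ⟨C₂, q₂, h₂⟩ := h₂
  refine ⟨|C₁| + |C₂|, max q₁ q₂, fun n => ?_⟩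
  have hn : (1 : ℝ) ≤ (n : ℝ) + 1 := by linarith [n.cast_nonneg (α := ℝ)]
  rw [add_apply, add_mul]
  refine add_le_add ((h₁ n).trans ?_) ((h₂ n).trans ?_)
  · gcongr
    exacts [le_abs_self _, le_max_left _ _]
  · gcongr
    exacts [le_abs_self _, le_max_right _ _]

theorem mono (h : HasPolynomialGrowth v p₂) (hp : ∀ φ, p₁ φ ≤ p₂ φ) :
    HasPolynomialGrowth v p₁ := by
  obtain ⟨C, q, h⟩ := h
  exact ⟨C, q, fun n => (hp _).trans (h n)⟩

theorem const_smul (h : HasPolynomialGrowth v p) (c : NNReal) : HasPolynomialGrowth v (c • p) := by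
  obtain ⟨C, q, h⟩ := h
  refine ⟨c * C, q, fun n => ?_⟩
  rw [smul_apply, NNReal.smul_def, smul_eq_mul, mul_assoc]
  exact mul_le_mul_of_nonneg_left (h n) c.2

/-- If the Schwartz seminorms grow polynomially along a sequence, so do all continuous
seminorms. -/
theorem of_continuous (h : ∀ k l, HasPolynomialGrowth v (SchwartzMap.seminorm ℂ k l))
    (hp : Continuous p) : HasPolynomialGrowth v p := by
  obtain ⟨s, C, -, hC⟩ := Seminorm.bound_of_continuous (schwartz_withSeminorms ℂ ℝ ℂ) p hp
  refine mono (const_smul ?_ C) hC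
  clear hC
  induction s using Finset.induction_on with
  | empty => exact ⟨0, 0, fun n => by simp⟩
  | insert i s hi ih =>
    rw [Finset.sup_insert]
    exact mono ((h i.1 i.2).add ih) fun φ => by
      rw [Seminorm.sup_apply, add_apply]
      exact max_le_add_of_nonneg (apply_nonneg _ _) (apply_nonneg _ _)

theorem comp_raising (h : HasPolynomialGrowth hermiteSchwartz p) :
    HasPolynomialGrowth hermiteSchwartz (p.comp raising.toLinearMap) := by
  obtain ⟨C, q, h⟩ := h
  refine ⟨2 * (|C| * 2 ^ q), q + 1, fun n => ?_⟩
  have hn : (0 : ℝ) ≤ n := n.cast_nonneg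
  rw [Seminorm.comp_apply, ContinuousLinearMap.coe_coe, raising_hermiteSchwartz, map_smul_eq_mul,
    Complex.norm_real, Real.norm_of_nonneg (Real.sqrt_nonneg _)]
  have h1 : Real.sqrt (2 * (n + 1)) ≤ 2 * (n + 1) := Real.sqrt_le_iff.2 ⟨by positivity, by nlinarith⟩
  have h2 : p (hermiteSchwartz (n + 1)) ≤ |C| * (2 ^ q * ((n : ℝ) + 1) ^ q) := by
    refine (h (n + 1)).trans ?_
    rw [← mul_pow]
    push_cast
    gcongr
    exacts [le_abs_self _, by linarith]
  calc _ ≤ 2 * ((n : ℝ) + 1) * (|C| * (2 ^ q * ((n : ℝ) + 1) ^ q)) := by gcongr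
    _ = _ := by ring

theorem comp_lowering (h : HasPolynomialGrowth hermiteSchwartz p) :
    HasPolynomialGrowth hermiteSchwartz (p.comp lowering.toLinearMap) := by
  obtain ⟨C, q, h⟩ := h
  refine ⟨2 * |C|, q + 1, fun n => ?_⟩
  rw [Seminorm.comp_apply, ContinuousLinearMap.coe_coe]
  cases n with
  | zero =>
    rw [lowering_hermiteSchwartz_zero, map_zero]
    positivity
  | succ n =>
    have hn : (0 : ℝ) ≤ n := n.cast_nonneg
    rw [lowering_hermiteSchwartz_succ, map_smul_eq_mul,
      Complex.norm_real, Real.norm_of_nonneg (Real.sqrt_nonneg _)]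
    have h1 : Real.sqrt (2 * (n + 1)) ≤ 2 * (n + 1 + 1) :=
      Real.sqrt_le_iff.2 ⟨by positivity, by nlinarith⟩
    have h2 : p (hermiteSchwartz n) ≤ |C| * ((n : ℝ) + 1 + 1) ^ q := by
      refine (h n).trans ?_
      gcongr
      exacts [le_abs_self _, by linarith]
    calc _ ≤ 2 * ((n : ℝ) + 1 + 1) * (|C| * ((n : ℝ) + 1 + 1) ^ q) := by gcongr
      _ = _ := by push_cast; ring

theorem comp_mulX (h : HasPolynomialGrowth hermiteSchwartz p) :
    HasPolynomialGrowth hermiteSchwartz (p.comp mulX.toLinearMap) := by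
  refine (h.comp_raising.add h.comp_lowering).mono fun φ => ?_
  rw [add_apply]
  simp only [Seminorm.comp_apply, ContinuousLinearMap.coe_coe]
  rw [mulX_eq, map_smul_eq_mul]
  have h1 := map_add_le_add p (raising φ) (lowering φ)
  have h2 : 0 ≤ p (raising φ + lowering φ) := apply_nonneg _ _
  norm_num
  linarith

theorem comp_derivCLM (h : HasPolynomialGrowth hermiteSchwartz p) :
    HasPolynomialGrowth hermiteSchwartz (p.comp (SchwartzMap.derivCLM ℂ ℂ).toLinearMap) := by
  refine (h.comp_raising.add h.comp_lowering).mono fun φ => ?_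
  rw [add_apply]
  simp only [Seminorm.comp_apply, ContinuousLinearMap.coe_coe]
  rw [derivCLM_eq, map_smul_eq_mul]
  have h1 := map_sub_le_add p (lowering φ) (raising φ)
  have h2 : 0 ≤ p (lowering φ - raising φ) := apply_nonneg _ _
  norm_num
  linarith

theorem comp_mulX_pow (h : HasPolynomialGrowth hermiteSchwartz p) (k : ℕ) :
    HasPolynomialGrowth hermiteSchwartz (p.comp (mulX ^ k).toLinearMap) := by
  induction k with
  | zero => exact h
  | succ k ih => rw [pow_succ]; exact ih.comp_mulX

theorem comp_derivCLM_pow (h : HasPolynomialGrowth hermiteSchwartz p) (l : ℕ) :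
    HasPolynomialGrowth hermiteSchwartz
      (p.comp ((SchwartzMap.derivCLM ℂ ℂ) ^ l).toLinearMap) := by
  induction l with
  | zero => exact h
  | succ l ih => rw [pow_succ]; exact ih.comp_derivCLM

end HasPolynomialGrowth

/-- Every Schwartz seminorm grows at most polynomially along the Hermite functions: by the
one-dimensional Sobolev inequality it is dominated by `L²` norms of derivatives and products with
powers of the variable, and these operations are combinations of the ladder operators. -/
theorem hasPolynomialGrowth_hermiteSchwartz (k l : ℕ) :
    HasPolynomialGrowth hermiteSchwartz (SchwartzMap.seminorm ℂ k l) := by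
  let N : Seminorm ℂ 𝓢(ℝ, ℂ) := (normSeminorm ℂ L2R).comp schwartzToL2.toLinearMap
  have hN : HasPolynomialGrowth hermiteSchwartz N :=
    ⟨1, 0, fun n => by
      simpa [N] using (orthonormal_hermiteSchwartz.1 n).le⟩
  refine ((hN.add hN.comp_derivCLM).comp_mulX_pow k).comp_derivCLM_pow l |>.mono fun φ => ?_
  refine SchwartzMap.seminorm_le_bound' ℂ k l φ (apply_nonneg _ _) fun x => ?_
  have h := norm_schwartz_apply_le ((mulX ^ k) (((SchwartzMap.derivCLM ℂ ℂ) ^ l) φ)) x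
  rw [mulX_pow_apply, ← iteratedDeriv_eq_derivCLM_iterate, norm_mul, norm_pow,
    Complex.norm_real, Real.norm_eq_abs] at h
  exact h

/-! ### Completeness of the Hermite functions -/

theorem inner_mulX_pow_hermiteSchwartz_eq_zero {g : L2R}
    (hg : ∀ n, inner ℂ (schwartzToL2 (hermiteSchwartz n)) g = 0) (k n : ℕ) :
    inner ℂ (schwartzToL2 ((mulX ^ k) (hermiteSchwartz n))) g = 0 := by
  induction k generalizing n with
  | zero => exact hg n
  | succ k ih =>
    have hr : inner ℂ (schwartzToL2 ((mulX ^ k) (raising (hermiteSchwartz n)))) g = 0 := by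
      rw [raising_hermiteSchwartz, map_smul, map_smul, inner_smul_left, ih, mul_zero]
    have hl : inner ℂ (schwartzToL2 ((mulX ^ k) (lowering (hermiteSchwartz n)))) g = 0 := by
      cases n with
      | zero => rw [lowering_hermiteSchwartz_zero, map_zero, map_zero, inner_zero_left]
      | succ n =>
        rw [lowering_hermiteSchwartz_succ, map_smul, map_smul, inner_smul_left, ih, mul_zero]
    rw [pow_succ, mul_apply_eq_comp, mulX_eq, map_smul, map_smul, inner_smul_left, map_add,
      map_add, inner_add_left, hr, hl, add_zero, mul_zero]

theorem integral_pow_mul_gaussian_mul_eq_zero {g : L2R}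
    (hg : ∀ n, inner ℂ (schwartzToL2 (hermiteSchwartz n)) g = 0) (k : ℕ) :
    ∫ x : ℝ, (x : ℂ) ^ k * ((Real.exp (-(x ^ 2 / 2)) : ℂ) * g x) = 0 := by
  have h := inner_mulX_pow_hermiteSchwartz_eq_zero hg k 0
  rw [hermiteSchwartz, map_smul, map_smul, inner_smul_left, hermiteUnnormalized_zero] at h
  have h0 : (starRingEnd ℂ) (hermiteNormalization 0 : ℂ) ≠ 0 := by
    rw [Complex.conj_ofReal]
    exact_mod_cast (hermiteNormalization_pos 0).ne'
  replace h := (mul_eq_zero.1 h).resolve_left h0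
  rw [L2.inner_def] at h
  rw [← h]
  refine integral_congr_ae ?_
  filter_upwards [SchwartzMap.coeFn_toLp ((mulX ^ k) schwartzGaussian) 2 volume] with x hx
  have hx' : (schwartzToL2 ((mulX ^ k) schwartzGaussian) : ℝ → ℂ) x =
      x ^ k * (Real.exp (-(x ^ 2 / 2)) : ℂ) := by
    rw [SchwartzMap.toLpCLM_apply, hx, mulX_pow_apply, schwartzGaussian_apply]
  rw [hx', RCLike.inner_apply, map_mul, map_pow, Complex.conj_ofReal, Complex.conj_ofReal]
  ring

theorem integrable_exp_mul_abs_mul_gaussian_mul (g : L2R) (c : ℝ) :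
    Integrable fun x : ℝ => Real.exp (c * |x|) * ‖(Real.exp (-(x ^ 2 / 2)) : ℂ) * g x‖ := by
  have h1 : MemLp (fun x : ℝ => Real.exp (-(1 / 4) * x ^ 2)) 2 volume := by
    rw [memLp_two_iff_integrable_sq (by fun_prop)]
    refine (integrable_exp_neg_mul_sq (b := 1 / 2) (by norm_num)).congr
      (Eventually.of_forall fun x => ?_)
    simp only
    rw [← Real.exp_nat_mul]
    congr 1
    push_cast
    ring
  have h2 : Integrable fun x : ℝ => Real.exp (-(1 / 4) * x ^ 2) * ‖g x‖ :=
    h1.integrable_mul (Lp.memLp g).norm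
  refine (h2.const_mul (Real.exp (c ^ 2))).mono' ?_ (Eventually.of_forall fun x => ?_)
  · have hgm := (Lp.memLp g).1
    have h3 : AEStronglyMeasurable (fun x : ℝ => (Real.exp (-(x ^ 2 / 2)) : ℂ)) volume :=
      (Complex.continuous_ofReal.comp (by fun_prop)).aestronglyMeasurable
    exact (by fun_prop : Continuous fun x : ℝ => Real.exp (c * |x|)).aestronglyMeasurable.mul
      (h3.mul hgm).norm
  · rw [norm_mul, norm_norm, norm_mul, Complex.norm_real, Real.norm_eq_abs, Real.norm_eq_abs,
      Real.abs_exp, Real.abs_exp, ← mul_assoc, ← mul_assoc, ← Real.exp_add, ← Real.exp_add]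
    refine mul_le_mul_of_nonneg_right (Real.exp_le_exp.2 ?_) (norm_nonneg _)
    nlinarith [sq_nonneg (c - |x| / 2), sq_abs x]

/-- A function of `L²(ℝ)` orthogonal to all Hermite functions vanishes: its product with the
Gaussian has exponential moments and vanishing moments, so its Fourier transform is zero. -/
theorem eq_zero_of_forall_inner_hermiteSchwartz {g : L2R}
    (hg : ∀ n, inner ℂ (schwartzToL2 (hermiteSchwartz n)) g = 0) : g = 0 := by
  set G : ℝ → ℂ := fun x => (Real.exp (-(x ^ 2 / 2)) : ℂ) * g x with hG
  have hGm : AEStronglyMeasurable G volume := by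
    have h3 : AEStronglyMeasurable (fun x : ℝ => (Real.exp (-(x ^ 2 / 2)) : ℂ)) volume :=
      (Complex.continuous_ofReal.comp (by fun_prop)).aestronglyMeasurable
    exact h3.mul (Lp.memLp g).1
  have hGi : Integrable G := by
    have h := integrable_exp_mul_abs_mul_gaussian_mul g 0
    simp only [zero_mul, Real.exp_zero, one_mul] at h
    exact (integrable_norm_iff hGm).1 h
  have hF (w : ℝ) : FourierTransform.fourier G w = 0 := by
    set z : ℂ := -2 * Real.pi * Complex.I * w with hz
    have hs : HasSum (fun k : ℕ => ∫ x : ℝ, (z * x) ^ k / (k.factorial : ℂ) * G x)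
        (∫ x : ℝ, Complex.exp (z * x) * G x) := by
      refine hasSum_integral_of_dominated_convergence
        (fun k x => (‖z‖ * |x|) ^ k / (k.factorial : ℝ) * ‖G x‖) (fun k => ?_) (fun k => ?_) ?_ ?_ ?_
      · refine AEStronglyMeasurable.mul ?_ hGm
        exact (Continuous.div_const ((continuous_const.mul Complex.continuous_ofReal).pow k)
          _).aestronglyMeasurable
      · refine Eventually.of_forall fun x => ?_
        simp
      · exact Eventually.of_forall fun x => (Real.summable_pow_div_factorial _).mul_right _
      · simp only [tsum_mul_right]
        refine (integrable_exp_mul_abs_mul_gaussian_mul g ‖z‖).congr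
          (Eventually.of_forall fun x => ?_)
        simp only [Real.exp_eq_exp_ℝ, NormedSpace.exp_eq_tsum_div, hG]
      · refine Eventually.of_forall fun x => ?_
        have := NormedSpace.expSeries_div_hasSum_exp (z * (x : ℂ))
        rw [← Complex.exp_eq_exp_ℂ] at this
        exact this.mul_right _
    have hterm (k : ℕ) : ∫ x : ℝ, (z * x) ^ k / (k.factorial : ℂ) * G x = 0 := by
      have h := integral_pow_mul_gaussian_mul_eq_zero hg k
      calc _ = ∫ x : ℝ, (z ^ k / (k.factorial : ℂ)) * ((x : ℂ) ^ k * G x) := by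
            congr 1; ext x; rw [mul_pow]; ring
        _ = 0 := by rw [integral_const_mul, h, mul_zero]
    simp only [hterm] at hs
    rw [Real.fourier_eq']
    rw [← hs.unique hasSum_zero]
    congr 1
    ext x
    rw [smul_eq_mul, hz]
    congr 2
    simp
    ring
  have hG0 : G =ᵐ[volume] 0 := by
    refine ae_eq_zero_of_integral_contDiff_smul_eq_zero hGi.locallyIntegrable fun χ hχ hχc => ?_
    let φ : 𝓢(ℝ, ℂ) := HasCompactSupport.toSchwartzMap (f := fun x => (χ x : ℂ))
      (hχc.comp_left Complex.ofReal_zero) (Complex.ofRealCLM.contDiff.comp hχ)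
    have h1 : ∀ x, φ x = (χ x : ℂ) := fun x => rfl
    have h2 := VectorFourier.integral_fourierIntegral_smul_eq_flip (L := innerₗ ℝ)
      Real.continuous_fourierChar continuous_inner
      (FourierTransform.fourierInv φ).integrable hGi (μ := volume) (ν := volume)
    have h3 : VectorFourier.fourierIntegral Real.fourierChar volume (innerₗ ℝ)
        (FourierTransform.fourierInv φ : 𝓢(ℝ, ℂ)) = φ := by
      have h : FourierTransform.fourier (FourierTransform.fourierInv φ : 𝓢(ℝ, ℂ)) = φ :=
        FourierTransform.fourier_fourierInv_eq φ
      exact congrArg (fun ψ : 𝓢(ℝ, ℂ) => (ψ : ℝ → ℂ)) h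
    have h4 : VectorFourier.fourierIntegral Real.fourierChar volume (innerₗ ℝ).flip G = 0 := by
      rw [flip_innerₗ]
      exact funext hF
    rw [h3, h4] at h2
    simpa [h1] using h2
  refine Lp.ext ?_
  filter_upwards [hG0, Lp.coeFn_zero ℂ 2 (volume : Measure ℝ)] with x hx hx0
  rw [hx0]
  refine (mul_eq_zero.1 hx).resolve_left ?_
  exact_mod_cast (Real.exp_pos _).ne'

/-- The Hermite functions as a Hilbert basis of `L²(ℝ)`. -/
def hermiteHilbertBasis : HilbertBasis ℕ ℂ L2R :=
  HilbertBasis.mkOfOrthogonalEqBot orthonormal_hermiteSchwartz (by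
    rw [Submodule.eq_bot_iff]
    intro g hg
    refine eq_zero_of_forall_inner_hermiteSchwartz fun n => ?_
    exact (Submodule.mem_orthogonal _ g).1 hg _ (Submodule.subset_span (Set.mem_range_self n)))

theorem hermiteHilbertBasis_apply (n : ℕ) :
    hermiteHilbertBasis n = schwartzToL2 (hermiteSchwartz n) := by
  rw [hermiteHilbertBasis, HilbertBasis.coe_mkOfOrthogonalEqBot]

/-! ### Operators on square-summable sequences -/

/-- The space of square-summable complex sequences. -/
abbrev SqSummableSeq : Type := lp (fun _ : ℕ => ℂ) 2

namespace SqSummableSeq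

theorem sum_sq_le (x : SqSummableSeq) (s : Finset ℕ) : ∑ i ∈ s, ‖x i‖ ^ 2 ≤ ‖x‖ ^ 2 := by
  have h := lp.sum_rpow_le_norm_rpow (p := 2) (by norm_num) x s
  simpa using h

theorem norm_le_of_sum_sq_le {x : SqSummableSeq} {C : ℝ} (hC : 0 ≤ C)
    (h : ∀ s : Finset ℕ, ∑ i ∈ s, ‖x i‖ ^ 2 ≤ C ^ 2) : ‖x‖ ≤ C :=
  lp.norm_le_of_forall_sum_le (p := 2) (by norm_num) hC fun s => by simpa using h s

theorem memLp_of_sum_sq_le {f : ℕ → ℂ} {C : ℝ} (h : ∀ s : Finset ℕ, ∑ i ∈ s, ‖f i‖ ^ 2 ≤ C) :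
    Memℓp f 2 :=
  memℓp_gen' (C := C) fun s => by simpa using h s

/-- **Schur's test** for an operator on square-summable sequences. -/
theorem norm_le_of_schur (D : SqSummableSeq →L[ℂ] SqSummableSeq) (a : ℕ → ℕ → ℝ) {K : ℝ}
    (hK : 0 ≤ K) (ha : ∀ m n, 0 ≤ a m n) (hD : ∀ m n, ‖D (lp.single 2 n 1) m‖ ≤ a m n)
    (hrow : ∀ m, ∀ s : Finset ℕ, ∑ n ∈ s, a m n ≤ K)
    (hcol : ∀ n, ∀ s : Finset ℕ, ∑ m ∈ s, a m n ≤ K) : ‖D‖ ≤ K := by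
  refine D.opNorm_le_bound hK fun x => ?_
  have hx : Tendsto (fun s : Finset ℕ => D (∑ n ∈ s, lp.single 2 n (x n))) atTop (𝓝 (D x)) :=
    (D.continuous.tendsto x).comp (lp.hasSum_single (by norm_num) x)
  refine le_of_tendsto hx.norm (Eventually.of_forall fun s => ?_)
  refine norm_le_of_sum_sq_le (by positivity) fun t => ?_
  have hentry (m : ℕ) : ‖D (∑ n ∈ s, lp.single 2 n (x n)) m‖ ≤ ∑ n ∈ s, a m n * ‖x n‖ := by
    have h1 : D (∑ n ∈ s, lp.single 2 n (x n)) = ∑ n ∈ s, x n • D (lp.single 2 n 1) := by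
      rw [map_sum]
      refine Finset.sum_congr rfl fun n _ => ?_
      rw [← map_smul, ← lp.single_smul, smul_eq_mul, mul_one]
    rw [h1, lp.coeFn_sum, Finset.sum_apply]
    refine (norm_sum_le _ _).trans (Finset.sum_le_sum fun n _ => ?_)
    rw [lp.coeFn_smul, Pi.smul_apply, norm_smul, mul_comm]
    exact mul_le_mul_of_nonneg_right (hD m n) (norm_nonneg _)
  have hsq (m : ℕ) : ‖D (∑ n ∈ s, lp.single 2 n (x n)) m‖ ^ 2 ≤
      K * ∑ n ∈ s, a m n * ‖x n‖ ^ 2 := by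
    calc _ ≤ (∑ n ∈ s, a m n * ‖x n‖) ^ 2 := by gcongr; exact hentry m
      _ ≤ (∑ n ∈ s, a m n) * ∑ n ∈ s, a m n * ‖x n‖ ^ 2 :=
        Finset.sum_sq_le_sum_mul_sum_of_sq_le_mul s (fun n _ => ha m n)
          (fun n _ => mul_nonneg (ha m n) (by positivity)) (fun n _ => le_of_eq (by ring))
      _ ≤ _ := mul_le_mul_of_nonneg_right (hrow m s)
          (Finset.sum_nonneg fun n _ => mul_nonneg (ha m n) (by positivity))
  calc ∑ m ∈ t, ‖D (∑ n ∈ s, lp.single 2 n (x n)) m‖ ^ 2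
      ≤ ∑ m ∈ t, K * ∑ n ∈ s, a m n * ‖x n‖ ^ 2 := Finset.sum_le_sum fun m _ => hsq m
    _ = K * ∑ n ∈ s, (∑ m ∈ t, a m n) * ‖x n‖ ^ 2 := by
        rw [← Finset.mul_sum, Finset.sum_comm]
        simp only [Finset.sum_mul]
    _ ≤ K * ∑ n ∈ s, K * ‖x n‖ ^ 2 := by
        gcongr with n _
        exact hcol n t
    _ = K ^ 2 * ∑ n ∈ s, ‖x n‖ ^ 2 := by rw [← Finset.mul_sum]; ring
    _ ≤ (K * ‖x‖) ^ 2 := by rw [mul_pow]; gcongr; exact sum_sq_le x s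

/-- The diagonal operator of a bounded real sequence. -/
def diagonal (w : ℕ → ℝ) (hw : ∃ M, ∀ n, |w n| ≤ M) : SqSummableSeq →L[ℂ] SqSummableSeq :=
  have hsum (x : SqSummableSeq) (s : Finset ℕ) :
      ∑ n ∈ s, ‖(w n : ℂ) * x n‖ ^ 2 ≤ (hw.choose * ‖x‖) ^ 2 := by
    have hM := hw.choose_spec
    calc _ ≤ ∑ n ∈ s, hw.choose ^ 2 * ‖x n‖ ^ 2 := by
          refine Finset.sum_le_sum fun n _ => ?_
          rw [norm_mul, mul_pow, Complex.norm_real, Real.norm_eq_abs]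
          gcongr
          exact hM n
      _ ≤ _ := by rw [← Finset.mul_sum, mul_pow]; gcongr; exact sum_sq_le x s
  LinearMap.mkContinuous
    { toFun := fun x => ⟨fun n => (w n : ℂ) * x n, memLp_of_sum_sq_le (hsum x)⟩
      map_add' := fun x y => by
        ext n
        exact mul_add _ _ _
      map_smul' := fun c x => by
        ext n
        exact mul_left_comm _ _ _ } hw.choose fun x =>
    norm_le_of_sum_sq_le
      (mul_nonneg ((abs_nonneg _).trans (hw.choose_spec 0)) (norm_nonneg _)) (hsum x)

theorem diagonal_apply (w : ℕ → ℝ) (hw : ∃ M, ∀ n, |w n| ≤ M) (x : SqSummableSeq) (n : ℕ) :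
    diagonal w hw x n = w n * x n := rfl

theorem diagonal_single (w : ℕ → ℝ) (hw : ∃ M, ∀ n, |w n| ≤ M) (n : ℕ) :
    diagonal w hw (lp.single 2 n 1) = (w n : ℂ) • lp.single 2 n (1 : ℂ) := by
  ext m
  rw [diagonal_apply, lp.coeFn_smul, Pi.smul_apply, smul_eq_mul]
  by_cases h : m = n
  · subst h; rfl
  · rw [lp.single_apply_ne _ _ _ h, mul_zero, mul_zero]

theorem inner_diagonal_left (w : ℕ → ℝ) (hw : ∃ M, ∀ n, |w n| ≤ M) (x y : SqSummableSeq) :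
    inner ℂ (diagonal w hw x) y = inner ℂ x (diagonal w hw y) := by
  rw [lp.inner_eq_tsum, lp.inner_eq_tsum]
  congr 1
  ext n
  rw [diagonal_apply, diagonal_apply, RCLike.inner_apply, RCLike.inner_apply, map_mul,
    Complex.conj_ofReal]
  ring

end SqSummableSeq

/-! ### Off-diagonal decay and the weights -/

theorem exists_sum_offDiagonal_le : ∃ K : ℝ, 0 ≤ K ∧ ∀ m : ℕ, ∀ s : Finset ℕ,
    ∑ n ∈ s, ((1 + |(m : ℝ) - n|) ^ 2)⁻¹ ≤ K := by
  have hs : Summable fun j : ℤ => ((1 + |(j : ℝ)|) ^ 2)⁻¹ := by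
    have h1 : Summable fun j : ℕ => (((j : ℝ) + 1) ^ 2)⁻¹ := by
      have := (summable_nat_add_iff 1).2 (Real.summable_nat_pow_inv.2 one_lt_two)
      simpa using this
    refine Summable.of_nat_of_neg ?_ ?_
    · refine h1.congr fun j => ?_
      rw [Int.cast_natCast, Nat.abs_cast, add_comm]
    · refine h1.congr fun j => ?_
      rw [Int.cast_neg, Int.cast_natCast, abs_neg, Nat.abs_cast, add_comm]
  refine ⟨∑' j : ℤ, ((1 + |(j : ℝ)|) ^ 2)⁻¹, tsum_nonneg fun j => by positivity, fun m s => ?_⟩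
  have hinj : Set.InjOn (fun n : ℕ => (m : ℤ) - n) s := fun a _ b _ h => by
    simp only at h
    omega
  refine le_trans (le_of_eq ?_)
    (hs.sum_le_tsum (s.image fun n : ℕ => (m : ℤ) - n) fun j _ => by positivity)
  rw [Finset.sum_image hinj]
  push_cast
  rfl

/-- The polynomial weight of degree `K` and slope `δ`, truncated at `R` so that it is bounded and
acts on all square-summable sequences. -/
def truncatedWeight (δ : ℝ) (K R n : ℕ) : ℝ := (1 + δ * (min n R : ℕ)) ^ K

section truncatedWeight

variable {δ : ℝ} (K R : ℕ)

theorem one_le_truncatedWeight (hδ : 0 ≤ δ) (n : ℕ) : 1 ≤ truncatedWeight δ K R n :=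
  one_le_pow₀ (le_add_of_nonneg_right (by positivity))

theorem truncatedWeight_bounded (hδ : 0 ≤ δ) : ∃ M, ∀ n, |truncatedWeight δ K R n| ≤ M := by
  refine ⟨(1 + δ * R) ^ K, fun n => ?_⟩
  rw [abs_of_nonneg (zero_le_one.trans (one_le_truncatedWeight K R hδ n)), truncatedWeight]
  gcongr
  exact min_le_right _ _

theorem inv_truncatedWeight_bounded (hδ : 0 ≤ δ) :
    ∃ M, ∀ n, |(truncatedWeight δ K R n)⁻¹| ≤ M := by
  refine ⟨1, fun n => ?_⟩
  have h := one_le_truncatedWeight K R hδ n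
  rw [abs_of_nonneg (inv_nonneg.2 (zero_le_one.trans h))]
  exact inv_le_one_of_one_le₀ h

/-- Quotients of weights differ from `1` by `O(δ)`, at the cost of a power of the distance to the
diagonal. This is uniform in the truncation `R`. -/
theorem abs_truncatedWeight_div_sub_one_le (hδ : 0 ≤ δ) (hδ1 : δ ≤ 1) (m n : ℕ) :
    |truncatedWeight δ K R m * (truncatedWeight δ K R n)⁻¹ - 1| ≤
      δ * K * (1 + |(m : ℝ) - n|) ^ (K + 1) := by
  set a : ℝ := ((min m R : ℕ) : ℝ) with ha
  set b : ℝ := ((min n R : ℕ) : ℝ) with hb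
  have ha0 : 0 ≤ a := by positivity
  have hb0 : 0 ≤ b := by positivity
  have hab : |a - b| ≤ |(m : ℝ) - n| := by
    rw [ha, hb, Nat.cast_min, Nat.cast_min]
    exact (abs_min_sub_min_le_max _ _ _ _).trans (by simp)
  set t : ℝ := 1 + |(m : ℝ) - n| with ht
  have ht1 : 1 ≤ t := by simp [ht]
  have hpos : 0 < 1 + δ * b := by positivity
  set r : ℝ := (1 + δ * a) / (1 + δ * b) with hr
  have hr1 : r - 1 = δ * (a - b) / (1 + δ * b) := by
    rw [hr]; field_simp; ring
  have hr2 : |r - 1| ≤ δ * |(m : ℝ) - n| := by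
    rw [hr1, abs_div, abs_mul, abs_of_nonneg hδ, abs_of_pos hpos]
    refine (div_le_self (by positivity) (by nlinarith)).trans ?_
    gcongr
  have hr0 : 0 ≤ r := by positivity
  have hrt : r ≤ t := by
    have h1 := le_abs_self (r - 1)
    have h2 : δ * |(m : ℝ) - n| ≤ 1 * |(m : ℝ) - n| := by gcongr
    linarith
  have heq : truncatedWeight δ K R m * (truncatedWeight δ K R n)⁻¹ = r ^ K := by
    rw [truncatedWeight, truncatedWeight, hr, div_pow, div_eq_mul_inv]
  have h := abs_pow_sub_pow_le r 1 K
  rw [one_pow, abs_one, abs_of_nonneg hr0] at h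
  rw [heq]
  calc |r ^ K - 1| ≤ |r - 1| * K * max r 1 ^ (K - 1) := h
    _ ≤ (δ * t) * K * t ^ K := by
        gcongr
        · exact hr2.trans (by gcongr; simp [ht])
        · calc max r 1 ^ (K - 1) ≤ t ^ (K - 1) := by gcongr; exact max_le hrt ht1
            _ ≤ t ^ K := pow_le_pow_right₀ ht1 (Nat.sub_le _ _)
    _ = _ := by ring

end truncatedWeight

/-- A sequence is rapidly decreasing if its product with each polynomial is bounded. -/
def IsRapidlyDecreasing (c : ℕ → ℂ) : Prop :=
  ∀ K : ℕ, ∃ C : ℝ, ∀ n : ℕ, ((n : ℝ) + 1) ^ K * ‖c n‖ ≤ C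

/-- The entries of the infinite matrix `M` decay faster than each power of the distance to the
diagonal. -/
def HasOffDiagonalDecay (M : ℕ → ℕ → ℂ) : Prop :=
  ∀ s : ℕ, ∃ C : ℝ, ∀ m n : ℕ, ‖M m n‖ * (1 + |(m : ℝ) - n|) ^ s ≤ C

open SqSummableSeq

/-- Conjugation by a truncated weight of small slope is a small perturbation of an operator with
off-diagonal decay, uniformly in the truncation. The second part is the same statement for the
inverse weight. -/
theorem exists_weight_conj_sub_le (T : SqSummableSeq →L[ℂ] SqSummableSeq)
    (hT : HasOffDiagonalDecay fun m n => T (lp.single 2 n 1) m) (K : ℕ) {ε : ℝ} (hε : 0 < ε) :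
    ∃ δ, ∃ hδ : 0 < δ, δ ≤ 1 ∧ ∀ R : ℕ,
      ‖diagonal (truncatedWeight δ K R) (truncatedWeight_bounded K R hδ.le) * T *
        diagonal (fun n => (truncatedWeight δ K R n)⁻¹) (inv_truncatedWeight_bounded K R hδ.le) - T‖
          ≤ ε ∧
      ‖diagonal (fun n => (truncatedWeight δ K R n)⁻¹) (inv_truncatedWeight_bounded K R hδ.le) * T *
        diagonal (truncatedWeight δ K R) (truncatedWeight_bounded K R hδ.le) - T‖ ≤ ε := by
  obtain ⟨B, hB0, hB⟩ := exists_sum_offDiagonal_le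
  obtain ⟨c, hc⟩ := hT (K + 3)
  have hc0 : 0 ≤ c := le_trans (by positivity) (hc 0 0)
  set δ : ℝ := min 1 (ε / (K * c * B + 1)) with hδdef
  have hδ : 0 < δ := lt_min one_pos (by positivity)
  have hδ1 : δ ≤ 1 := min_le_left _ _
  have hδε : δ * K * c * B ≤ ε := by
    have h1 : δ * (K * c * B + 1) ≤ ε := by
      rw [← le_div_iff₀ (by positivity)]
      exact min_le_right _ _
    nlinarith
  have key (D : SqSummableSeq →L[ℂ] SqSummableSeq)
      (hD : ∀ m n, ‖D (lp.single 2 n 1) m‖ ≤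
        δ * K * (1 + |(m : ℝ) - n|) ^ (K + 1) * ‖T (lp.single 2 n 1) m‖) : ‖D‖ ≤ ε := by
    refine (norm_le_of_schur D (fun m n => δ * K * c * ((1 + |(m : ℝ) - n|) ^ 2)⁻¹)
      (K := δ * K * c * B) (by positivity) (fun m n => by positivity) (fun m n => ?_)
      (fun m s => ?_) (fun n s => ?_)).trans hδε
    · refine (hD m n).trans ?_
      have ht : 0 < 1 + |(m : ℝ) - n| := by positivity
      rw [mul_assoc, mul_assoc (δ * K)]
      refine mul_le_mul_of_nonneg_left ?_ (by positivity)
      rw [← div_eq_mul_inv, le_div_iff₀ (by positivity)]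
      refine le_trans (le_of_eq ?_) (hc m n)
      ring
    · rw [← Finset.mul_sum]
      exact mul_le_mul_of_nonneg_left (hB m s) (by positivity)
    · rw [← Finset.mul_sum]
      refine mul_le_mul_of_nonneg_left ?_ (by positivity)
      simpa only [abs_sub_comm] using hB n s
  have hconj (w w' : ℕ → ℝ) (hw : ∃ M, ∀ n, |w n| ≤ M) (hw' : ∃ M, ∀ n, |w' n| ≤ M) (m n : ℕ) :
      (diagonal w hw * T * diagonal w' hw' - T) (lp.single 2 n 1) m =
        ((w m * w' n - 1 : ℝ) : ℂ) * T (lp.single 2 n 1) m := by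
    rw [_root_.sub_apply, mul_apply_eq_comp, mul_apply_eq_comp, diagonal_single, map_smul, map_smul,
      lp.coeFn_sub, Pi.sub_apply, lp.coeFn_smul, Pi.smul_apply, diagonal_apply, smul_eq_mul]
    push_cast
    ring
  refine ⟨δ, hδ, hδ1, fun R => ⟨key _ fun m n => ?_, key _ fun m n => ?_⟩⟩
  · rw [hconj, norm_mul, Complex.norm_real, Real.norm_eq_abs]
    gcongr
    exact abs_truncatedWeight_div_sub_one_le K R hδ.le hδ1 m n
  · rw [hconj, norm_mul, Complex.norm_real, Real.norm_eq_abs, mul_comm (_⁻¹), abs_sub_comm (m : ℝ)]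
    gcongr
    exact abs_truncatedWeight_div_sub_one_le K R hδ.le hδ1 n m

/-- Spectral invariance, in the form of a regularity statement:
if `T` has off-diagonal decay and is bounded below, and `x` solves the normal equation
`T† T x = y` with `y` rapidly decreasing, then `T x` is rapidly decreasing. -/
theorem isRapidlyDecreasing_of_normal_equation (T : SqSummableSeq →L[ℂ] SqSummableSeq)
    (hT : HasOffDiagonalDecay fun m n => T (lp.single 2 n 1) m) {A : ℝ} (hA : 0 < A)
    (hTA : ∀ z, A * ‖z‖ ^ 2 ≤ ‖T z‖ ^ 2) {x y : SqSummableSeq}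
    (hxy : ∀ z, inner ℂ (T z) (T x) = inner ℂ z y) (hy : IsRapidlyDecreasing y) :
    IsRapidlyDecreasing (T x) := by
  intro K
  -- The error terms below add up to `(2 ‖T‖ + ε) ε ≤ A / 2`.
  set ε : ℝ := min 1 (A / 2 / (2 * ‖T‖ + 1)) with hεdef
  have hε : 0 < ε := lt_min one_pos (by positivity)
  have hε1 : ε ≤ 1 := min_le_left _ _
  have hεA : (2 * ‖T‖ + 1) * ε ≤ A / 2 := by
    rw [mul_comm, ← le_div_iff₀ (by positivity)]
    exact min_le_right _ _
  obtain ⟨δ, hδ, hδ1, hconj⟩ := exists_weight_conj_sub_le T hT K hε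
  obtain ⟨b, hb⟩ := hy (K + 1)
  have hb0 : 0 ≤ b := le_trans (by positivity) (hb 0)
  obtain ⟨B, hB0, hB⟩ := exists_sum_offDiagonal_le
  -- `M` bounds the weighted norm of `y`, whatever the truncation.
  set M : ℝ := b * (B + 1) with hM
  refine ⟨δ⁻¹ ^ K * ((‖T‖ + 1) * (2 / A * M)), fun m => ?_⟩
  -- Truncating at `m` leaves the weight of the entry `m` unchanged.
  obtain ⟨h1, h2⟩ := hconj m
  set W := diagonal (truncatedWeight δ K m) (truncatedWeight_bounded K m hδ.le) with hW
  set V := diagonal (fun n => (truncatedWeight δ K m n)⁻¹)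
    (inv_truncatedWeight_bounded K m hδ.le) with hV
  have hw0 (n : ℕ) : (truncatedWeight δ K m n : ℂ) ≠ 0 :=
    Complex.ofReal_ne_zero.2 (zero_lt_one.trans_le (one_le_truncatedWeight K m hδ.le n)).ne'
  have hVW (z : SqSummableSeq) : V (W z) = z := by
    ext n
    rw [hV, hW, diagonal_apply, diagonal_apply, Complex.ofReal_inv, inv_mul_cancel_left₀ (hw0 n)]
  set v := W x with hv
  set D₁ := W * T * V - T with hD₁
  set D₂ := V * T * W - T with hD₂
  have e1 : T v + D₁ v = W (T x) := by
    rw [hD₁, _root_.sub_apply, add_sub_cancel, mul_apply_eq_comp, mul_apply_eq_comp, hv, hVW]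
  have e2 : T v + D₂ v = V (T (W v)) := by
    rw [hD₂, _root_.sub_apply, add_sub_cancel, mul_apply_eq_comp, mul_apply_eq_comp]
  have hWy : ‖W y‖ ≤ M := by
    refine norm_le_of_sum_sq_le (by positivity) fun s => ?_
    have hterm (n : ℕ) : ‖W y n‖ ^ 2 ≤ b ^ 2 * ((1 + |((0 : ℕ) : ℝ) - n|) ^ 2)⁻¹ := by
      have hwn : truncatedWeight δ K m n ≤ ((n : ℝ) + 1) ^ K := by
        rw [truncatedWeight]
        have h3 : ((min n m : ℕ) : ℝ) ≤ n := by exact_mod_cast min_le_left _ _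
        have h4 : δ * ((min n m : ℕ) : ℝ) ≤ 1 * n := by gcongr
        exact pow_le_pow_left₀ (by positivity) (by linarith) K
      have h0 := zero_le_one.trans (one_le_truncatedWeight K m hδ.le n)
      have h5 : ((n : ℝ) + 1) * ‖W y n‖ ≤ b := by
        refine le_trans ?_ (hb n)
        rw [hW, diagonal_apply, norm_mul, Complex.norm_real, Real.norm_of_nonneg h0, pow_succ',
          mul_assoc]
        gcongr
      rw [Nat.cast_zero, zero_sub, abs_neg, Nat.abs_cast, ← div_eq_mul_inv,
        le_div_iff₀ (by positivity), ← mul_pow]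
      gcongr
      rw [mul_comm, add_comm]
      exact h5
    calc _ ≤ ∑ n ∈ s, b ^ 2 * ((1 + |((0 : ℕ) : ℝ) - n|) ^ 2)⁻¹ :=
          Finset.sum_le_sum fun n _ => hterm n
      _ ≤ b ^ 2 * B := by
          rw [← Finset.mul_sum]
          gcongr
          exact hB 0 s
      _ ≤ M ^ 2 := by
          rw [hM, mul_pow]
          gcongr
          nlinarith
  -- The conjugated frame operator is `W (T† T) W⁻¹ = (T + D₂)† (T + D₁)`.
  have hin : inner ℂ (T v + D₂ v) (T v + D₁ v) = inner ℂ v (W y) := by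
    rw [e1, e2, hV, inner_diagonal_left, ← hV, hVW, hxy, hW, inner_diagonal_left]
  have hD₁v : ‖D₁ v‖ ≤ ε * ‖v‖ := (D₁.le_opNorm v).trans (by gcongr)
  have hD₂v : ‖D₂ v‖ ≤ ε * ‖v‖ := (D₂.le_opNorm v).trans (by gcongr)
  have hTv : ‖T v‖ ≤ ‖T‖ * ‖v‖ := T.le_opNorm v
  have hmain : ‖T v‖ ^ 2 ≤ ‖v‖ * ‖W y‖ + (2 * ‖T‖ + 1) * ε * ‖v‖ ^ 2 := by
    have hexp : inner ℂ (T v) (T v) = inner ℂ v (W y) - inner ℂ (T v) (D₁ v) -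
        inner ℂ (D₂ v) (T v) - inner ℂ (D₂ v) (D₁ v) := by
      rw [← hin, inner_add_left, inner_add_right, inner_add_right]
      ring
    have hn : ‖T v‖ ^ 2 = ‖(inner ℂ (T v) (T v) : ℂ)‖ := by
      rw [inner_self_eq_norm_sq_to_K, norm_pow, RCLike.norm_ofReal, abs_norm]
    rw [hn, hexp]
    have t1 : ‖(inner ℂ v (W y) : ℂ)‖ ≤ ‖v‖ * ‖W y‖ := norm_inner_le_norm _ _
    have t2 : ‖(inner ℂ (T v) (D₁ v) : ℂ)‖ ≤ (‖T‖ * ‖v‖) * (ε * ‖v‖) :=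
      (norm_inner_le_norm _ _).trans (by gcongr)
    have t3 : ‖(inner ℂ (D₂ v) (T v) : ℂ)‖ ≤ (ε * ‖v‖) * (‖T‖ * ‖v‖) :=
      (norm_inner_le_norm _ _).trans (by gcongr)
    have t4 : ‖(inner ℂ (D₂ v) (D₁ v) : ℂ)‖ ≤ (ε * ‖v‖) * (1 * ‖v‖) :=
      (norm_inner_le_norm _ _).trans (by gcongr; exact hD₁v.trans (by gcongr))
    refine (norm_sub_le _ _).trans ?_
    refine (add_le_add ((norm_sub_le _ _).trans (add_le_add (norm_sub_le _ _) le_rfl))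
      le_rfl).trans ?_
    linarith
  have hvb : ‖v‖ ≤ 2 / A * M := by
    have h3 := (hTA v).trans hmain
    have h4 : (2 * ‖T‖ + 1) * ε * ‖v‖ ^ 2 ≤ A / 2 * ‖v‖ ^ 2 := by gcongr
    have h5 : A / 2 * ‖v‖ ^ 2 ≤ ‖v‖ * M := by
      have : ‖v‖ * ‖W y‖ ≤ ‖v‖ * M := by gcongr
      linarith
    rcases (norm_nonneg v).eq_or_lt with h0 | h0
    · rw [← h0]; positivity
    · have h6 : A / 2 * ‖v‖ ≤ M := by
        apply le_of_mul_le_mul_left _ h0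
        linarith
      rw [div_mul_eq_mul_div, le_div_iff₀ hA]
      linarith
  have hWT : ‖W (T x) m‖ ≤ (‖T‖ + 1) * (2 / A * M) := by
    refine (lp.norm_apply_le_norm (by norm_num) _ _).trans ?_
    rw [← e1]
    refine (norm_add_le _ _).trans ?_
    calc _ ≤ ‖T‖ * ‖v‖ + 1 * ‖v‖ := add_le_add hTv (hD₁v.trans (by gcongr))
      _ = (‖T‖ + 1) * ‖v‖ := by ring
      _ ≤ _ := by gcongr
  rw [hW, diagonal_apply, norm_mul, Complex.norm_real, truncatedWeight, min_self,
    Real.norm_of_nonneg (by positivity)] at hWT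
  have hwm : ((m : ℝ) + 1) ^ K ≤ δ⁻¹ ^ K * (1 + δ * m) ^ K := by
    rw [← mul_pow, mul_add, mul_one, inv_mul_cancel_left₀ hδ.ne']
    have := (one_le_inv₀ hδ).2 hδ1
    exact pow_le_pow_left₀ (by positivity) (by linarith) K
  calc ((m : ℝ) + 1) ^ K * ‖T x m‖ ≤ δ⁻¹ ^ K * (1 + δ * m) ^ K * ‖T x m‖ := by gcongr
    _ = δ⁻¹ ^ K * ((1 + δ * m) ^ K * ‖T x m‖) := by ring
    _ ≤ _ := by gcongr

/-! ### Localized frames -/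

section Frame

variable {H : Type*} [NormedAddCommGroup H] [InnerProductSpace ℂ H]

/-- The analysis operator `h ↦ ((h, u n))_n` of a frame is bounded, and bounded below. -/
theorem exists_analysis_operator {u : ℕ → H} (hu : IsFrame u) :
    ∃ T : H →L[ℂ] SqSummableSeq, (∀ h n, T h n = inner ℂ (u n) h) ∧
      ∃ A > (0 : ℝ), ∀ h, A * ‖h‖ ^ 2 ≤ ‖T h‖ ^ 2 := by
  obtain ⟨A, hA, B, hB, hu⟩ := hu
  have hmem (h : H) : Memℓp (fun n => inner ℂ (u n) h) 2 :=
    memℓp_gen (by simpa using (hu h).1)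
  let T₀ : H →ₗ[ℂ] SqSummableSeq :=
    { toFun := fun h => ⟨fun n => inner ℂ (u n) h, hmem h⟩
      map_add' := fun x y => by
        ext n
        exact inner_add_right _ _ _
      map_smul' := fun c x => by
        ext n
        exact inner_smul_right _ _ _ }
  have hnorm (h : H) : ‖T₀ h‖ ^ 2 = ∑' n, ‖inner ℂ (u n) h‖ ^ 2 := by
    have := lp.norm_rpow_eq_tsum (p := 2) (by norm_num) (T₀ h)
    simpa [T₀] using this
  refine ⟨T₀.mkContinuous (Real.sqrt B) fun h => ?_, fun h n => rfl, A, hA, fun h => ?_⟩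
  · refine (sq_le_sq₀ (norm_nonneg _) (by positivity)).1 ?_
    rw [hnorm, mul_pow, Real.sq_sqrt hB.le]
    exact (hu h).2.2
  · exact (hu h).2.1.trans (hnorm h).ge

/-- A vector whose coordinates in an orthonormal basis are rapidly decreasing has an expansion with
rapidly decreasing coefficients along each frame that is localized with respect to the basis. -/
theorem exists_isRapidlyDecreasing_frame_expansion [CompleteSpace H] {u : ℕ → H} (hu : IsFrame u)
    (b : HilbertBasis ℕ ℂ H) (hub : HasOffDiagonalDecay fun m n => inner ℂ (u m) (b n))
    {h : H} (hh : IsRapidlyDecreasing fun n => inner ℂ (b n) h) :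
    ∃ c : ℕ → ℂ, IsRapidlyDecreasing c ∧ HasSum (fun n => c n • u n) h := by
  obtain ⟨T, hT, A, hA, hTA⟩ := exists_analysis_operator hu
  have hunit : IsUnit (T.adjoint.comp T) := by
    refine ContinuousLinearMap.isUnit_of_forall_le_norm_inner_map _ (c := ⟨A, hA.le⟩) hA fun x => ?_
    rw [ContinuousLinearMap.comp_apply, ContinuousLinearMap.adjoint_inner_left,
      inner_self_eq_norm_sq_to_K, norm_pow, RCLike.norm_ofReal, abs_norm, mul_comm]
    exact hTA x
  obtain ⟨S, hS⟩ := hunit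
  obtain ⟨z, hz⟩ : ∃ z, T.adjoint (T z) = h := by
    refine ⟨(↑S⁻¹ : H →L[ℂ] H) h, ?_⟩
    have h1 : ((S : H →L[ℂ] H) * (↑S⁻¹ : H →L[ℂ] H)) h = h := by simp
    rwa [hS] at h1
  let J : SqSummableSeq →L[ℂ] H := (b.repr.symm : SqSummableSeq →L[ℂ] H)
  have hJ (x : SqSummableSeq) : J x = b.repr.symm x := rfl
  refine ⟨T z, ?_, ?_⟩
  · have h2 := isRapidlyDecreasing_of_normal_equation (T.comp J) (A := A) (x := b.repr z)
      (y := b.repr h) ?_ hA (fun x => ?_) (fun x => ?_) ?_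
    · simpa [hJ] using h2
    · simpa [hJ, hT, HilbertBasis.repr_symm_single] using hub
    · rw [ContinuousLinearMap.comp_apply, hJ]
      simpa using hTA (b.repr.symm x)
    · rw [ContinuousLinearMap.comp_apply, ContinuousLinearMap.comp_apply, hJ, hJ,
        LinearIsometryEquiv.symm_apply_apply, ← ContinuousLinearMap.adjoint_inner_right, hz,
        ← LinearIsometryEquiv.inner_map_map b.repr, LinearIsometryEquiv.apply_symm_apply]
    · rwa [show (b.repr h : ℕ → ℂ) = fun n => inner ℂ (b n) h from
        funext fun n => b.repr_apply_apply h n]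
  · have hsingle (n : ℕ) : T.adjoint (lp.single 2 n 1) = u n := by
      refine ext_inner_right ℂ fun x => ?_
      rw [ContinuousLinearMap.adjoint_inner_left, lp.inner_single_left, hT]
      simp
    have h3 := (lp.hasSum_single (by norm_num) (T z)).mapL T.adjoint
    rw [hz] at h3
    have h4 (n : ℕ) : T.adjoint (lp.single 2 n (T z n)) = T z n • u n := by
      rw [← hsingle, ← map_smul, ← lp.single_smul, smul_eq_mul, mul_one]
    simpa only [h4] using h3

end Frame

/-! ### Expansions in the Schwartz space -/

theorem summable_norm_mul_of_isRapidlyDecreasing {c : ℕ → ℂ} (hc : IsRapidlyDecreasing c)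
    (C : ℝ) (q : ℕ) : Summable fun n : ℕ => ‖c n‖ * (C * ((n : ℝ) + 1) ^ q) := by
  obtain ⟨B, hB⟩ := hc (q + 2)
  have h1 : Summable fun j : ℕ => |C| * B * (((j : ℝ) + 1) ^ 2)⁻¹ := by
    have := (summable_nat_add_iff 1).2 (Real.summable_nat_pow_inv.2 one_lt_two)
    refine Summable.mul_left _ ?_
    simpa using this
  refine Summable.of_norm_bounded h1 fun n => ?_
  have hn : (0 : ℝ) < (n : ℝ) + 1 := by positivity
  rw [norm_mul, norm_norm, norm_mul, Real.norm_eq_abs, Real.norm_of_nonneg (by positivity),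
    ← div_eq_mul_inv, le_div_iff₀ (by positivity)]
  calc _ = |C| * (((n : ℝ) + 1) ^ (q + 2) * ‖c n‖) := by ring
    _ ≤ _ := by gcongr; exact hB n

theorem hasSum_schwartz_of_hasSum_L2 {v : ℕ → 𝓢(ℝ, ℂ)}
    (hv : ∀ k l, HasPolynomialGrowth v (SchwartzMap.seminorm ℂ k l)) {c : ℕ → ℂ}
    (hc : IsRapidlyDecreasing c) {φ : 𝓢(ℝ, ℂ)}
    (hφ : HasSum (fun n => c n • schwartzToL2 (v n)) (schwartzToL2 φ)) :
    HasSum (fun n => c n • v n) φ := by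
  refine hasSum_schwartz_of_hasSum_toLp (fun k l => ?_) ?_
  · obtain ⟨C, q, hC⟩ := hv k l
    refine Summable.of_nonneg_of_le (fun n => apply_nonneg _ _) (fun n => ?_)
      (summable_norm_mul_of_isRapidlyDecreasing hc C q)
    rw [map_smul_eq_mul]
    gcongr
    exact hC n
  · simp only [← map_smul] at hφ
    exact hφ

theorem isRapidlyDecreasing_inner_hermiteSchwartz (φ : 𝓢(ℝ, ℂ)) :
    IsRapidlyDecreasing fun n => inner ℂ (schwartzToL2 (hermiteSchwartz n)) (schwartzToL2 φ) :=
  exists_norm_inner_hermiteSchwartz_le φ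

theorem hasSum_hermite_expansion (φ : 𝓢(ℝ, ℂ)) : HasSum (fun n =>
    (inner ℂ (schwartzToL2 (hermiteSchwartz n)) (schwartzToL2 φ) : ℂ) • hermiteSchwartz n) φ := by
  refine hasSum_schwartz_of_hasSum_L2 hasPolynomialGrowth_hermiteSchwartz
    (isRapidlyDecreasing_inner_hermiteSchwartz φ) ?_
  have h := hermiteHilbertBasis.hasSum_repr (schwartzToL2 φ)
  simpa only [HilbertBasis.repr_apply_apply, hermiteHilbertBasis_apply] using h

/-- Schwartz functions that are localized with respect to the Hermite functions inherit the
polynomial growth of their seminorms. -/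
theorem hasPolynomialGrowth_of_hasOffDiagonalDecay {v : ℕ → 𝓢(ℝ, ℂ)}
    (hv : HasOffDiagonalDecay fun m n =>
      inner ℂ (schwartzToL2 (v m)) (schwartzToL2 (hermiteSchwartz n))) (k l : ℕ) :
    HasPolynomialGrowth v (SchwartzMap.seminorm ℂ k l) := by
  obtain ⟨C, q, hC⟩ := hasPolynomialGrowth_hermiteSchwartz k l
  obtain ⟨c, hc⟩ := hv (q + 2)
  obtain ⟨B, hB0, hB⟩ := exists_sum_offDiagonal_le
  have hC0 : 0 ≤ C := by simpa using (apply_nonneg _ _).trans (hC 0)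
  have hc0 : 0 ≤ c := le_trans (by positivity) (hc 0 0)
  refine ⟨c * C * B, q, fun m => ?_⟩
  have hp : Continuous (SchwartzMap.seminorm ℂ k l : 𝓢(ℝ, ℂ) → ℝ) :=
    (schwartz_withSeminorms ℂ ℝ ℂ).continuous_seminorm (k, l)
  refine le_of_tendsto ((hp.tendsto (v m)).comp (hasSum_hermite_expansion (v m)))
    (Eventually.of_forall fun s => ?_)
  refine (Finset.le_sum_of_subadditive _ (map_zero _).le (map_add_le_add _) _ _).trans ?_
  have hterm (n : ℕ) : SchwartzMap.seminorm ℂ k l ((inner ℂ (schwartzToL2 (hermiteSchwartz n))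
      (schwartzToL2 (v m)) : ℂ) • hermiteSchwartz n) ≤
        c * C * ((m : ℝ) + 1) ^ q * ((1 + |(m : ℝ) - n|) ^ 2)⁻¹ := by
    have hm : (0 : ℝ) ≤ m := m.cast_nonneg
    -- `n + 1 ≤ (m + 1) (1 + |m - n|)` trades growth in `n` for growth in `m`.
    have hnm : (n : ℝ) + 1 ≤ (m + 1) * (1 + |(m : ℝ) - n|) := by
      have h1 := neg_abs_le ((m : ℝ) - n)
      nlinarith [mul_nonneg hm (abs_nonneg ((m : ℝ) - n))]
    rw [map_smul_eq_mul, norm_inner_symm, ← div_eq_mul_inv, le_div_iff₀ (by positivity)]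
    set a : ℝ := ‖(inner ℂ (schwartzToL2 (v m)) (schwartzToL2 (hermiteSchwartz n)) : ℂ)‖
    calc a * SchwartzMap.seminorm ℂ k l (hermiteSchwartz n) * (1 + |(m : ℝ) - n|) ^ 2
        ≤ a * (C * ((m + 1) * (1 + |(m : ℝ) - n|)) ^ q) * (1 + |(m : ℝ) - n|) ^ 2 := by
          gcongr
          exact (hC n).trans (by gcongr)
      _ = (a * (1 + |(m : ℝ) - n|) ^ (q + 2)) * (C * ((m : ℝ) + 1) ^ q) := by
          rw [mul_pow]
          ring
      _ ≤ c * (C * ((m : ℝ) + 1) ^ q) := by gcongr; exact hc m n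
      _ = _ := by ring
  calc _ ≤ ∑ n ∈ s, c * C * ((m : ℝ) + 1) ^ q * ((1 + |(m : ℝ) - n|) ^ 2)⁻¹ :=
        Finset.sum_le_sum fun n _ => hterm n
    _ ≤ c * C * ((m : ℝ) + 1) ^ q * B := by
        rw [← Finset.mul_sum]
        gcongr
        exact hB m s
    _ = _ := by ring

/-! ### Families of functionals on a localized frame -/

/-- A family of functionals on the Schwartz space that is bounded by a power of `n` on the frame
elements and converges on each of them converges pointwise. -/
theorem exists_tendsto_of_tendsto_on_frame {v : ℕ → 𝓢(ℝ, ℂ)}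
    (hv : IsFrame fun n => schwartzToL2 (v n))
    (hloc : HasOffDiagonalDecay fun m n =>
      inner ℂ (schwartzToL2 (v m)) (schwartzToL2 (hermiteSchwartz n)))
    {ι : Type*} {𝓁 : Filter ι} (F : ι → 𝓢(ℝ, ℂ) →L[ℂ] ℂ)
    (hlim : ∀ n, ∃ a, Tendsto (fun i => F i (v n)) 𝓁 (𝓝 a)) {C : ℝ} {k : ℕ}
    (hbound : ∀ᶠ i in 𝓁, ∀ n : ℕ, ‖F i (v n)‖ ≤ C * ((n : ℝ) + 1) ^ k) (φ : 𝓢(ℝ, ℂ)) :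
    ∃ a, Tendsto (fun i => F i φ) 𝓁 (𝓝 a) := by
  obtain ⟨c, hc, hφ⟩ := exists_isRapidlyDecreasing_frame_expansion hv hermiteHilbertBasis
    (by simpa only [hermiteHilbertBasis_apply] using hloc) (h := schwartzToL2 φ)
    (by simpa only [hermiteHilbertBasis_apply] using isRapidlyDecreasing_inner_hermiteSchwartz φ)
  have hsum := hasSum_schwartz_of_hasSum_L2 (hasPolynomialGrowth_of_hasOffDiagonalDecay hloc) hc hφ
  have hF (i : ι) : F i φ = ∑' n, c n * F i (v n) := by
    have h := (hsum.mapL (F i)).tsum_eq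
    simp only [map_smul, smul_eq_mul] at h
    exact h.symm
  choose a ha using hlim
  refine ⟨∑' n, c n * a n, ?_⟩
  simp only [hF]
  refine tendsto_tsum_of_dominated_convergence
    (summable_norm_mul_of_isRapidlyDecreasing hc C k) (fun n => (ha n).const_mul _) ?_
  filter_upwards [hbound] with i hi n
  rw [norm_mul]
  gcongr
  exact hi n

theorem exists_temperedDistribution_of_tendsto {ι : Type*} {𝓁 : Filter ι} [𝓁.NeBot]
    [𝓁.IsCountablyGenerated] (F : ι → 𝓢(ℝ, ℂ) →L[ℂ] ℂ) {G : 𝓢(ℝ, ℂ) → ℂ}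
    (h : ∀ φ, Tendsto (fun i => F i φ) 𝓁 (𝓝 (G φ))) : ∃ g : 𝓢'(ℝ, ℂ), ∀ φ, g φ = G φ :=
  ⟨ContinuousLinearMap.toPointwiseConvergenceCLM ℂ (RingHom.id ℂ) 𝓢(ℝ, ℂ) ℂ
    (continuousLinearMapOfTendsto F (tendsto_pi_nhds.2 h)), fun _ => rfl⟩

theorem IsFrame.comp_equiv {H ι κ : Type*} [NormedAddCommGroup H] [InnerProductSpace ℂ H]
    {u : ι → H} (hu : IsFrame u) (σ : κ ≃ ι) : IsFrame (u ∘ σ) := by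
  obtain ⟨A, hA, B, hB, h⟩ := hu
  refine ⟨A, hA, B, hB, fun x => ?_⟩
  have hs := σ.tsum_eq fun i => ‖inner ℂ (u i) x‖ ^ 2
  simp only [Function.comp_apply]
  rw [hs]
  exact ⟨σ.summable_iff (f := fun i => ‖inner ℂ (u i) x‖ ^ 2) |>.2 (h x).1, (h x).2⟩

theorem hasOffDiagonalDecay_of_isPolynomiallyLocalized {u : ℕ+ → L2R}
    (hu : ∀ s : ℕ, 0 < s → IsPolynomiallyLocalized (s : ℝ) u hermiteBasis) :
    HasOffDiagonalDecay fun m n =>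
      inner ℂ (u m.succPNat) (schwartzToL2 (hermiteSchwartz n)) := by
  intro s
  obtain ⟨r', -, C, hC⟩ := hu (s + 1) s.succ_pos
  refine ⟨C, fun m n => ?_⟩
  have h := (le_max_left _ _).trans (hC m.succPNat n.succPNat)
  have hmn : ((m.succPNat : ℕ) : ℝ) - (n.succPNat : ℕ) = (m : ℝ) - n := by
    simp only [Nat.succPNat_coe, Nat.succ_eq_add_one]
    push_cast
    ring
  rw [hermiteBasis_eq, Nat.natPred_succPNat, norm_inner_symm, hmn, Real.rpow_neg (by positivity),
    Real.rpow_natCast, ← div_eq_mul_inv, le_div_iff₀ (by positivity)] at h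
  refine le_trans ?_ h
  gcongr
  · simp
  · exact s.le_succ

/-- The continuous functional `φ ↦ ⟨f(l ·), φ⟩ / (l ^ α L(l))`. -/
def normalizedDilation (f : 𝓢'(ℝ, ℂ)) (α : ℝ) (L : ℝ → ℝ) (l : ℝ) : 𝓢(ℝ, ℂ) →L[ℂ] ℂ where
  toFun φ := dilateDistribution l f φ / ((l ^ α * L l : ℝ) : ℂ)
  map_add' φ ψ := by rw [map_add, add_div]
  map_smul' c φ := by rw [map_smul, smul_eq_mul, mul_div_assoc]; rfl
  cont := (map_continuous (dilateDistribution l f)).div_const _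

theorem normalizedDilation_apply (f : 𝓢'(ℝ, ℂ)) (α : ℝ) (L : ℝ → ℝ) (l : ℝ) (φ : 𝓢(ℝ, ℂ)) :
    normalizedDilation f α L l φ = dilateDistribution l f φ / ((l ^ α * L l : ℝ) : ℂ) := rfl

theorem norm_normalizedDilation (f : 𝓢'(ℝ, ℂ)) {α : ℝ} {L : ℝ → ℝ} {l : ℝ}
    (hl : 0 < l ^ α * L l) (φ : 𝓢(ℝ, ℂ)) :
    ‖normalizedDilation f α L l φ‖ = ‖dilateDistribution l f φ‖ / (l ^ α * L l) := by
  rw [normalizedDilation_apply, norm_div, Complex.norm_real, Real.norm_of_nonneg hl.le]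

/-- The Banach–Steinhaus part: functionals that converge pointwise along `atTop` are eventually
bounded by one power of `n` on sequences along which continuous seminorms grow polynomially. -/
theorem exists_polynomial_bound_of_tendsto {v : ℕ → 𝓢(ℝ, ℂ)}
    (hv : ∀ k l, HasPolynomialGrowth v (SchwartzMap.seminorm ℂ k l))
    (F : ℝ → 𝓢(ℝ, ℂ) →L[ℂ] ℂ) (hF : ∀ φ, ∃ a, Tendsto (fun l => F l φ) atTop (𝓝 a)) (A : ℝ) :
    ∃ k : ℕ, ∃ l₀ ≥ A, ∃ C : ℝ, ∀ l ≥ l₀, ∀ n : ℕ, ‖F l (v n)‖ ≤ C * ((n : ℝ) + 1) ^ k := by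
  by_contra! hcon
  choose l hl n hn using fun k : ℕ => hcon k (A + k) (le_add_of_nonneg_right k.cast_nonneg) k
  have hlt : Tendsto l atTop atTop :=
    tendsto_atTop_mono hl (tendsto_atTop_add_const_left _ A tendsto_natCast_atTop_atTop)
  obtain ⟨p, hp, hpF⟩ := exists_seminorm_bound_of_pointwise_bounded (fun k => F (l k)) fun φ => by
    obtain ⟨a, ha⟩ := hF φ
    obtain ⟨C, hC⟩ := (ha.comp hlt).norm.bddAbove_range
    exact ⟨C, fun k => hC ⟨k, rfl⟩⟩
  obtain ⟨C, q, hC⟩ := HasPolynomialGrowth.of_continuous hv hp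
  obtain ⟨k, hk⟩ := exists_nat_ge C
  -- At the index `max k q` both the constant and the exponent of the bound are beaten.
  have h1 := ((hn (max k q)).trans_le (hpF _ _)).trans_le (hC _)
  refine h1.not_ge ?_
  have h2 : C ≤ ((max k q : ℕ) : ℝ) := hk.trans (by exact_mod_cast le_max_left _ _)
  gcongr
  · exact le_add_of_nonneg_left (Nat.cast_nonneg _)
  · exact le_max_right _ _

end

theorem theorem6p2 (e : ℕ+ → 𝓢(ℝ, ℂ))
    (he_frame : IsFrame (fun n => ((e n).toLp 2 : L2R)))
    (he_loc : ∀ s : ℕ, 0 < s →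
      IsPolynomiallyLocalized (s : ℝ) (fun n => ((e n).toLp 2 : L2R)) hermiteBasis)
    (L : ℝ → ℝ) (hL : IsSlowlyVaryingAtInfinity L) (α : ℝ) (f : 𝓢'(ℝ, ℂ)) :
    (∃ g : 𝓢'(ℝ, ℂ), IsQuasiasymptoticAtInfinity f g α L) ↔
      (∀ n : ℕ+, ∃ c : ℂ, Tendsto
        (fun l : ℝ => dilateDistribution l f (e n) / ((l ^ α * L l : ℝ) : ℂ)) atTop (𝓝 c)) ∧
      (∃ k : ℕ, ∃ l₀ > (0 : ℝ), ∃ C : ℝ, ∀ l ≥ l₀, ∀ n : ℕ+,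
        ‖dilateDistribution l f (e n)‖ / (l ^ α * L l * (n : ℝ) ^ k) ≤ C) := by
  obtain ⟨⟨A, hA, -, hLA⟩, -⟩ := hL
  have hpos {l : ℝ} (hl : A ≤ l) : 0 < l ^ α * L l :=
    mul_pos (Real.rpow_pos_of_pos (hA.trans_le hl) α) (hLA l hl)
  obtain ⟨v, hv⟩ : ∃ v : ℕ → 𝓢(ℝ, ℂ), ∀ n, v n = e n.succPNat := ⟨_, fun _ => rfl⟩
  have hev (n : ℕ+) : e n = v n.natPred := by rw [hv, PNat.succPNat_natPred]
  have hn (n : ℕ+) : (n : ℝ) = (n.natPred : ℝ) + 1 := by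
    exact_mod_cast (PNat.natPred_add_one n).symm
  have hframe : IsFrame fun n => schwartzToL2 (v n) := by
    simp only [hv]
    exact he_frame.comp_equiv Equiv.pnatEquivNat.symm
  have hloc : HasOffDiagonalDecay fun m n =>
      inner ℂ (schwartzToL2 (v m)) (schwartzToL2 (hermiteSchwartz n)) := by
    have h := hasOffDiagonalDecay_of_isPolynomiallyLocalized
      (u := fun n => schwartzToL2 (e n)) he_loc
    simpa only [hv] using h
  constructor
  · rintro ⟨g, hg⟩
    refine ⟨fun n => ⟨g (e n), hg (e n)⟩, ?_⟩
    obtain ⟨k, l₀, hl₀, C, hC⟩ := exists_polynomial_bound_of_tendsto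
      (hasPolynomialGrowth_of_hasOffDiagonalDecay hloc) (normalizedDilation f α L)
      (fun φ => ⟨g φ, hg φ⟩) A
    refine ⟨k, l₀, hA.trans_le hl₀, C, fun l hl n => ?_⟩
    have h := hC l hl n.natPred
    rw [norm_normalizedDilation f (hpos (hl₀.le.trans hl)), ← hev, ← hn] at h
    rwa [← div_div, div_le_iff₀ (pow_pos (by exact_mod_cast n.pos) k)]
  · rintro ⟨hlim, k, l₀, -, C, hC⟩
    have hbound : ∀ᶠ l in atTop, ∀ n : ℕ,
        ‖normalizedDilation f α L l (v n)‖ ≤ C * ((n : ℝ) + 1) ^ k := by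
      filter_upwards [eventually_ge_atTop l₀, eventually_ge_atTop A] with l hl hl' n
      have h := hC l hl n.succPNat
      rw [← hv, hn, Nat.natPred_succPNat, ← div_div, div_le_iff₀ (by positivity)] at h
      rwa [norm_normalizedDilation f (hpos hl')]
    have hconv := exists_tendsto_of_tendsto_on_frame hframe hloc (normalizedDilation f α L)
      (fun n => by rw [hv]; exact hlim n.succPNat) hbound
    choose G hG using hconv
    obtain ⟨g, hg⟩ := exists_temperedDistribution_of_tendsto _ hG
    refine ⟨g, fun φ => ?_⟩
    rw [hg]
    exact hG φ
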